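/- All topological groups are Hausdorff. For a subset or an element $X$ of a topological group, $\overline{\langle X\rangle}$ denotes the closed subgroup generated by $X$. A topological group $G$ is inductively monothetic if for every finite $F\subseteq G$ there is $g\in G$ with $\overline{\langle F\rangle}=\overline{\langle g\rangle}$. It is periodic if it is locally compact, totally disconnected, and $\overline{\langle g\rangle}$ is compact for every $g\in G$. For a periodic abelian group $G$ and a prime $p$, the $p$-primary component $G_p$ is the subgroup of all $g\in G$ for which $\overline{\langle g\rangle}$ is a profinite $p$-group. A topological group is $\Pi$-procyclic if it is periodic and abelian and each of its primary components $G_p$ is either a finite cyclic $p$-group (possibly trivial) or isomorphic to $\mathbb Z_p$. Isomorphisms are isomorphisms of topological groups; $\mathbb Z(p^\infty)$ (the Prüfer group) and $\mathbb Z(p^n)$ (the cyclic group of order $p^n$) are discrete. Theorem. Let $G$ be an inductively monothetic locally compact group. Then $G$ is (a) a 1-dimensional compact connected abelian group, or (b) (isomorphic to) a subgroup of the discrete group $\mathbb Q$, or (c) a periodic locally compact abelian group such that, for each prime $p$, $G_p$ is isomorphic to $\mathbb Q_p$, $\mathbb Z(p^\infty)$, $\mathbb Z_p$, or $\mathbb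 Z(p^{n_p})$ for some integer $n_p\ge 0$. If, moreover, $G$ is periodic, let $D$ be the closed subgroup generated by all $G_p$ isomorphic to $\mathbb Q_p$ or $\mathbb Z(p^\infty)$, and let $P$ be the closed subgroup generated by all $G_p$ isomorphic to $\mathbb Z_p$ or some $\mathbb Z(p^n)$, $n\ge0$. Then $D$ and $P$ are closed and characteristic (invariant under all automorphisms of the topological group $G$), and $G=D\oplus P$ algebraically and topologically. The subgroup $D$ is the largest divisible subgroup of $G$. The subgroup $P$ is $\Pi$-procyclic and contains every $\Pi$-procyclic subgroup $H$ of $G$ with $D\cap H$ trivial; it is also the largest among the $\Pi$-procyclic subgroups of $G$ that are topological direct summands of $G$. -/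

import Mathlib

/-- Every finite subset topologically generates a subgroup that is topologically generated by a
single element. -/
def IsInductivelyMonothetic (G : Type*) [Group G] [TopologicalSpace G]
    [IsTopologicalGroup G] : Prop :=
  ∀ F : Set G, F.Finite → ∃ g : G,
    (Subgroup.closure F).topologicalClosure = (Subgroup.zpowers g).topologicalClosure

/-- A periodic topological group: locally compact, totally disconnected, and each element
topologically generates a compact subgroup. -/
structure IsPeriodicGroup (G : Type*) [Group G] [TopologicalSpace G]
    [IsTopologicalGroup G] : Prop where
  locallyCompact : LocallyCompactSpace G
  totallyDisconnected : TotallyDisconnectedSpace G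
  compact_zpowers : ∀ g : G, IsCompact ((Subgroup.zpowers g).topologicalClosure : Set G)

/-- A profinite group all of whose open normal subgroups have `p`-power index. -/
structure IsProfinitePGroup (p : ℕ) (M : Type*) [Group M] [TopologicalSpace M] : Prop where
  compact : CompactSpace M
  t2 : T2Space M
  totallyDisconnected : TotallyDisconnectedSpace M
  index_eq_pow : ∀ U : Subgroup M, U.Normal → IsOpen (U : Set M) → ∃ n : ℕ, U.index = p ^ n

/-- `S` is the `p`-primary component (`p`-Sylow subgroup) of `G`: the elements of `S` are exactly
the `g` that topologically generate a profinite `p`-group. -/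
def IsPrimaryComponent {G : Type*} [Group G] [TopologicalSpace G] [IsTopologicalGroup G]
    (p : ℕ) (S : Subgroup G) : Prop :=
  ∀ g : G, g ∈ S ↔ IsProfinitePGroup p (Subgroup.zpowers g).topologicalClosure

/-- `S` is isomorphic, as a topological group, to the additive group of `p`-adic numbers. -/
def IsoPadic (p : ℕ) [Fact p.Prime] (S : Type*) [Group S] [TopologicalSpace S] : Prop :=
  Nonempty (S ≃ₜ* Multiplicative ℚ_[p])

/-- `S` is isomorphic, as a topological group, to the discrete Prüfer group, that is, the union of
the groups `p⁻ⁿℤ/ℤ` inside `ℝ/ℤ`, with the discrete topology. -/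
def IsoPrufer (p : ℕ) (S : Type*) [Group S] [TopologicalSpace S] : Prop :=
  DiscreteTopology S ∧
    Nonempty (S ≃* Multiplicative (AddCommGroup.primaryComponent UnitAddCircle p))

/-- `S` is isomorphic, as a topological group, to the additive group of `p`-adic integers. -/
def IsoPadicInt (p : ℕ) [Fact p.Prime] (S : Type*) [Group S] [TopologicalSpace S] : Prop :=
  Nonempty (S ≃ₜ* Multiplicative ℤ_[p])

/-- `S` is isomorphic, as a topological group, to the discrete cyclic group of order `pⁿ` for
some `n ≥ 0`. -/
def IsoCyclicPow (p : ℕ) (S : Type*) [Group S] [TopologicalSpace S] : Prop :=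
  ∃ n : ℕ, Nonempty (S ≃ₜ* Multiplicative (ZMod (p ^ n)))

/-- A `Π`-procyclic group: a periodic (locally compact) abelian group each of whose primary
components is a finite cyclic `p`-group or the group of `p`-adic integers. -/
structure IsPiProcyclic (G : Type*) [Group G] [TopologicalSpace G]
    [IsTopologicalGroup G] : Prop where
  comm : ∀ a b : G, a * b = b * a
  periodic : IsPeriodicGroup G
  primary : ∀ (p : ℕ) [Fact p.Prime], ∃ S : Subgroup G,
    IsPrimaryComponent p S ∧ (IsoPadicInt p S ∨ IsoCyclicPow p S)

/-- The closed subgroup generated by the primary components isomorphic to `ℚ_p` or `ℤ(p^∞)`. In a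
periodic abelian group this is the local product of these components. -/
def divisiblePart (G : Type*) [Group G] [TopologicalSpace G] [IsTopologicalGroup G] :
    Subgroup G :=
  (Subgroup.closure {g : G | ∃ (p : ℕ) (_ : Fact p.Prime) (S : Subgroup G),
    IsPrimaryComponent p S ∧ (IsoPadic p S ∨ IsoPrufer p S) ∧ g ∈ S}).topologicalClosure

/-- The closed subgroup generated by the primary components isomorphic to `ℤ_p` or `ℤ(p^n)`. In a
periodic abelian group this is the local product of these components. -/
def procyclicPart (G : Type*) [Group G] [TopologicalSpace G] [IsTopologicalGroup G] :
    Subgroup G :=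
  (Subgroup.closure {g : G | ∃ (p : ℕ) (_ : Fact p.Prime) (S : Subgroup G),
    IsPrimaryComponent p S ∧ (IsoPadicInt p S ∨ IsoCyclicPow p S) ∧ g ∈ S}).topologicalClosure

/-- `G` is algebraically and topologically the direct product (in additive terms, direct sum) of
its subgroups `A` and `B`. -/
def IsTopologicalDirectSum {G : Type*} [Group G] [TopologicalSpace G]
    (A B : Subgroup G) : Prop :=
  (∀ a ∈ A, ∀ b ∈ B, a * b = b * a) ∧ IsHomeomorph (fun x : A × B => (x.1 * x.2 : G))

/-- Invariance under all automorphisms of the topological group `G`. -/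
def IsTopologicallyCharacteristic {G : Type*} [Group G] [TopologicalSpace G]
    (H : Subgroup G) : Prop :=
  ∀ φ : G ≃ₜ* G, H.map (φ : G →* G) = H

/-- Divisibility of a subgroup, in multiplicative notation. -/
def IsDivisibleSubgroup {G : Type*} [Group G] (H : Subgroup G) : Prop :=
  ∀ n : ℕ, n ≠ 0 → ∀ h ∈ H, ∃ k ∈ H, k ^ n = h

/-! Two elements lie in the closure of one cyclic group, so the group is commutative. A finite
subgroup inside the image of a continuous homomorphism must be cyclic
(`IsInductivelyMonothetic.isCyclic_of_le_range`). `IsInductivelyMonothetic.false_of_prime_order`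
turns this into the recurring contradiction: an element of prime order `p` independent of a circle
would produce a copy of `(ℤ/p)²`.

Each element generates either a relatively compact group or an infinite discrete one. If some `g` is
of the second kind, `g` and any `h` are powers of a common element, so the logarithm to base `g`
embeds the group in `ℚ`; being countable, the group is discrete by Baire. Otherwise every compact
set lies in a compact open subgroup. A compact inductively monothetic group is totally disconnected
or connected, since otherwise a circle quotient of the identity component coexists with an element
of prime order in a finite quotient. A group that is not totally disconnected is therefore compact
and connected. Any two of its nontrivial characters are then multiplicatively dependent: the dual is
torsion-free of rank one. So fibres of nontrivial characters are totally disconnected and preimages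
of arcs form a basis, which gives dimension one. That characters separate points is proved by
Gelfand theory applied to the regular representation on `L²`.

In the periodic case the elements with `g ^ p ^ n → 1` form `G_p`, on which exponents extend to
`ℤ_p`. Divisibility in `ℤ_p` is total, so any two elements of `G_p` are comparable. Either one
element generates, giving `ℤ_p` or a finite cyclic group, or `p`-th roots exist indefinitely and
`ℚ_p` maps openly onto `G_p`; this map is injective or makes `G_p` a Prüfer group.

The direct sum comes from the idempotents of `∏ ℤ_q`: for a set `π` of primes, `primeProj` raises an
element to the idempotent of `π`. Applied to the primes with divisible component and to their
complement, it yields continuous complementary projections onto `D` and `P`. They commute with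
continuous homomorphisms, hence with automorphisms. Maximality follows because a `Π`-procyclic group
has no nontrivial divisible subgroup. -/

open MeasureTheory Filter Topology in
/-- The operator `v ↦ ∫ f(y) U(y) v dy` attached to a strongly continuous unitary representation of
a compact group and a continuous function. -/
noncomputable def integratedRep {G H : Type*} [Group G] [TopologicalSpace G] [CompactSpace G]
    [MeasurableSpace G] [BorelSpace G] (μ : Measure G) [IsFiniteMeasure μ]
    [NormedAddCommGroup H] [InnerProductSpace ℂ H] [CompleteSpace H]
    (U : G →* unitary (H →L[ℂ] H)) (hU : ∀ v : H, Continuous fun x => (U x : H →L[ℂ] H) v)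
    (f : C(G, ℂ)) : H →L[ℂ] H :=
  have hint : ∀ v : H, Integrable (fun y => f y • (U y : H →L[ℂ] H) v) μ := fun v =>
    ((f.continuous.smul (hU v)).integrable_of_hasCompactSupport (HasCompactSupport.of_compactSpace _))
  LinearMap.mkContinuous
    { toFun := fun v => ∫ y, f y • (U y : H →L[ℂ] H) v ∂μ
      map_add' := fun v w => by
        rw [← integral_add (hint v) (hint w)]
        simp
      map_smul' := fun c v => by
        rw [RingHom.id_apply, ← integral_smul]
        simp only [map_smul]
        congr 1
        ext y
        rw [smul_comm] } (‖f‖ * μ.real Set.univ) (fun v => by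
      have : ‖∫ y, f y • (U y : H →L[ℂ] H) v ∂μ‖ ≤ (‖f‖ * ‖v‖) * μ.real Set.univ := by
        apply norm_integral_le_of_norm_le_const
        filter_upwards with y
        rw [norm_smul]
        have h1 : ‖(U y : H →L[ℂ] H) v‖ = ‖v‖ := by
          exact Unitary.norm_map (U y) v
        rw [h1]
        gcongr
        exact f.norm_coe_le_norm y
      simp only [LinearMap.coe_mk, AddHom.coe_mk]
      linarith)

/-! ### Characters obtained from unitary representations of compact abelian groups. -/

section
open MeasureTheory Filter Topology

set_option linter.unusedSectionVars false

variable {G H : Type*} [CommGroup G] [TopologicalSpace G] [IsTopologicalGroup G] [CompactSpace G]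
    [MeasurableSpace G] [BorelSpace G] (μ : Measure G) [IsProbabilityMeasure μ]
    [NormedAddCommGroup H] [InnerProductSpace ℂ H] [CompleteSpace H]
    (U : G →* unitary (H →L[ℂ] H)) (hU : ∀ v : H, Continuous fun x => (U x : H →L[ℂ] H) v)

theorem integratedRep_apply (f : C(G, ℂ)) (v : H) :
    integratedRep μ U hU f v = ∫ y, f y • (U y : H →L[ℂ] H) v ∂μ := rfl

theorem integrable_smul_rep (hU : ∀ v : H, Continuous fun x => (U x : H →L[ℂ] H) v)
    (f : C(G, ℂ)) (v : H) : Integrable (fun y => f y • (U y : H →L[ℂ] H) v) μ :=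
  (f.continuous.smul (hU v)).integrable_of_hasCompactSupport (HasCompactSupport.of_compactSpace _)

theorem norm_integratedRep_le (f : C(G, ℂ)) : ‖integratedRep μ U hU f‖ ≤ ‖f‖ := by
  have := LinearMap.mkContinuous_norm_le (𝕜 := ℂ)
    (integratedRep μ U hU f : H →ₗ[ℂ] H) (C := ‖f‖) (norm_nonneg _) (fun v => by
      have : ‖∫ y, f y • (U y : H →L[ℂ] H) v ∂μ‖ ≤ (‖f‖ * ‖v‖) * μ.real Set.univ := by
        apply norm_integral_le_of_norm_le_const
        filter_upwards with y
        rw [norm_smul, Unitary.norm_map (U y) v]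
        gcongr
        exact f.norm_coe_le_norm y
      simpa [integratedRep_apply] using this)
  exact this

theorem integratedRep_sub (f g : C(G, ℂ)) :
    integratedRep μ U hU (f - g) = integratedRep μ U hU f - integratedRep μ U hU g := by
  ext v
  simp only [sub_apply, integratedRep_apply]
  rw [← integral_sub (integrable_smul_rep μ U hU f v) (integrable_smul_rep μ U hU g v)]
  simp [sub_smul]

theorem integratedRep_commute (f : C(G, ℂ)) (S : H →L[ℂ] H)
    (hS : ∀ x, S * (U x : H →L[ℂ] H) = U x * S) :
    S * integratedRep μ U hU f = integratedRep μ U hU f * S := by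
  ext v
  simp only [mul_apply_eq_comp, integratedRep_apply]
  rw [← ContinuousLinearMap.integral_comp_comm _ (integrable_smul_rep μ U hU f v)]
  congr 1
  ext y
  rw [map_smul]
  congr 1
  exact congrArg (fun T : H →L[ℂ] H => T v) (hS y)

/-- Left translation of a continuous function, as a continuous family. -/
noncomputable def translateMap (f : C(G, ℂ)) : C(G, C(G, ℂ)) :=
  ContinuousMap.curry ⟨fun p : G × G => f (p.1⁻¹ * p.2), by fun_prop⟩

theorem translateMap_apply (f : C(G, ℂ)) (x y : G) : translateMap f x y = f (x⁻¹ * y) := rfl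

theorem mul_integratedRep [μ.IsMulLeftInvariant] (f : C(G, ℂ)) (x : G) :
    (U x : H →L[ℂ] H) * integratedRep μ U hU f = integratedRep μ U hU (translateMap f x) := by
  ext v
  simp only [mul_apply_eq_comp, integratedRep_apply, translateMap_apply]
  rw [← ContinuousLinearMap.integral_comp_comm _ (integrable_smul_rep μ U hU f v)]
  rw [← integral_mul_left_eq_self (fun y => f (x⁻¹ * y) • (U y : H →L[ℂ] H) v) x]
  congr 1
  ext y
  simp [map_mul]

/-- With `w = U(a)g - g ≠ 0` and `f(y)` the conjugate of `⟨w, U(y)w⟩`, the number `⟨w, T_f w⟩` is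
the integral of `|⟨w, U(y)w⟩|²`, which is positive. Commutativity gives `(U(a) - 1) T_f g = T_f w ≠
0`. -/
theorem exists_integratedRep_ne [μ.IsOpenPosMeasure] {a : G} (ha : U a ≠ 1) :
    ∃ f : C(G, ℂ), ((U a : H →L[ℂ] H) - 1) * integratedRep μ U hU f ≠ 0 := by
  obtain ⟨g, hg⟩ : ∃ g, (U a : H →L[ℂ] H) g ≠ g := by
    by_contra! h
    apply ha
    ext v
    exact h v
  set w := (U a : H →L[ℂ] H) g - g with hw
  have hw0 : w ≠ 0 := sub_ne_zero.2 hg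
  refine ⟨⟨fun y => starRingEnd ℂ (inner ℂ w ((U y : H →L[ℂ] H) w)), ?_⟩, fun h0 => ?_⟩
  · exact Complex.continuous_conj.comp (Continuous.inner continuous_const (hU w))
  set f : C(G, ℂ) := ⟨fun y => starRingEnd ℂ (inner ℂ w ((U y : H →L[ℂ] H) w)),
    Complex.continuous_conj.comp (Continuous.inner continuous_const (hU w))⟩ with hf
  have hc : ((U a : H →L[ℂ] H) - 1) * integratedRep μ U hU f
      = integratedRep μ U hU f * ((U a : H →L[ℂ] H) - 1) := by
    apply integratedRep_commute
    intro x
    rw [sub_mul, mul_sub, ← Submonoid.coe_mul, ← Submonoid.coe_mul, ← map_mul, ← map_mul,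
      mul_comm x a]
    simp
  rw [hc] at h0
  have h1 : integratedRep μ U hU f w = 0 := by
    have := congrArg (fun T : H →L[ℂ] H => T g) h0
    simpa [hw] using this
  have h2 : inner ℂ w (integratedRep μ U hU f w) =
      ((∫ y, ‖inner ℂ w ((U y : H →L[ℂ] H) w)‖ ^ 2 ∂μ : ℝ) : ℂ) := by
    rw [integratedRep_apply, ← integral_inner (integrable_smul_rep μ U hU f w),
      ← integral_complex_ofReal]
    congr 1
    ext y
    rw [inner_smul_right]
    simp only [hf, ContinuousMap.coe_mk]
    rw [Complex.conj_mul']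
    simp
  rw [h1, inner_zero_right] at h2
  have h3 : ∫ y, ‖inner ℂ w ((U y : H →L[ℂ] H) w)‖ ^ 2 ∂μ = 0 := by exact_mod_cast h2.symm
  have hcont : Continuous fun y => ‖inner ℂ w ((U y : H →L[ℂ] H) w)‖ ^ 2 :=
    ((Continuous.inner continuous_const (hU w)).norm.pow 2)
  have h4 := hcont.integral_pos_of_hasCompactSupport_nonneg_nonzero (μ := μ) (x := 1)
    (HasCompactSupport.of_compactSpace _) (fun y => by positivity) (by simpa using hw0)
  exact h4.ne' h3

/-- The bicommutant of a commuting star-closed set of operators, as a commutative C⋆-algebra. -/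
noncomputable abbrev bicommutantCommCStarAlgebra (s : Set (H →L[ℂ] H))
    (hs : ∀ x ∈ s, ∀ y ∈ s, x * y = y * x) (hs' : star s = s) :
    CommCStarAlgebra
      (StarSubalgebra.centralizer ℂ (StarSubalgebra.centralizer ℂ s : Set (H →L[ℂ] H))) :=
  { (inferInstance : NormedRing (StarSubalgebra.centralizer ℂ
      (StarSubalgebra.centralizer ℂ s : Set (H →L[ℂ] H)))),
    (inferInstance : NormedAlgebra ℂ (StarSubalgebra.centralizer ℂ
      (StarSubalgebra.centralizer ℂ s : Set (H →L[ℂ] H)))),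
    (inferInstance : StarRing (StarSubalgebra.centralizer ℂ
      (StarSubalgebra.centralizer ℂ s : Set (H →L[ℂ] H)))),
    (inferInstance : StarModule ℂ (StarSubalgebra.centralizer ℂ
      (StarSubalgebra.centralizer ℂ s : Set (H →L[ℂ] H)))),
    (inferInstance : CStarRing (StarSubalgebra.centralizer ℂ
      (StarSubalgebra.centralizer ℂ s : Set (H →L[ℂ] H)))) with
    complete := by
      intro F hF
      have : IsClosed ((StarSubalgebra.centralizer ℂ
          (StarSubalgebra.centralizer ℂ s : Set (H →L[ℂ] H)) : Set (H →L[ℂ] H))) := by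
        rw [StarSubalgebra.coe_centralizer]
        exact Set.isClosed_centralizer _
      exact (this.completeSpace_coe).complete hF
    mul_comm := fun x y => by
      ext1
      have hx := x.2
      have hy := y.2
      rw [← SetLike.mem_coe, StarSubalgebra.coe_centralizer_centralizer, hs', Set.union_self]
        at hx hy
      have hss : s ⊆ s.centralizer := fun x hx y hy => hs y hy x hx
      exact (hx _ (Set.centralizer_subset hss hy)).symm }

/-- The Gelfand transform of a commutative C⋆-algebra is isometric, hence injective. -/
theorem exists_algHom_apply_ne_zero {A : Type*} [CommCStarAlgebra A] {z : A} (hz : z ≠ 0) :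
    ∃ φ : A →ₐ[ℂ] ℂ, φ z ≠ 0 := by
  by_contra! h
  apply hz
  apply (gelfandTransform_isometry A).injective
  ext φ
  rw [map_zero]
  exact h (WeakDual.CharacterSpace.toAlgHom φ)

theorem exists_algHom_bicommutant_apply_ne_zero (s : Set (H →L[ℂ] H))
    (hs : ∀ x ∈ s, ∀ y ∈ s, x * y = y * x) (hs' : star s = s)
    {z : StarSubalgebra.centralizer ℂ (StarSubalgebra.centralizer ℂ s : Set (H →L[ℂ] H))}
    (hz : z ≠ 0) :
    ∃ φ : StarSubalgebra.centralizer ℂ (StarSubalgebra.centralizer ℂ s : Set (H →L[ℂ] H)) →ₐ[ℂ] ℂ,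
      φ z ≠ 0 ∧ ∀ x, ‖φ x‖ ≤ ‖x‖ := by
  let := bicommutantCommCStarAlgebra s hs hs'
  have : Nontrivial
      (StarSubalgebra.centralizer ℂ (StarSubalgebra.centralizer ℂ s : Set (H →L[ℂ] H))) :=
    ⟨z, 0, hz⟩
  obtain ⟨φ, hφ⟩ := exists_algHom_apply_ne_zero hz
  exact ⟨φ, hφ, fun x => AlgHom.norm_apply_le_self φ x⟩

include hU in
/-- A strongly continuous unitary representation of a compact abelian group which is nontrivial
at `a` yields a continuous character which is nontrivial at `a`. -/
theorem exists_character_ne_one_of_rep [μ.IsOpenPosMeasure] [μ.IsMulLeftInvariant] {a : G}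
    (ha : U a ≠ 1) : ∃ χ : G →* Circle, Continuous χ ∧ χ a ≠ 1 := by
  set s : Set (H →L[ℂ] H) := Set.range fun x => (U x : H →L[ℂ] H) with hs
  have hcomm : ∀ x ∈ s, ∀ y ∈ s, x * y = y * x := by
    rintro _ ⟨x, rfl⟩ _ ⟨y, rfl⟩
    simp only
    rw [← Submonoid.coe_mul, ← Submonoid.coe_mul, ← map_mul, ← map_mul, mul_comm]
  have hstar : ∀ x, star (U x : H →L[ℂ] H) = U x⁻¹ := fun x => by
    rw [map_inv]; rfl
  have hss : star s = s := by
    ext T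
    constructor
    · rintro ⟨x, hx⟩
      refine ⟨x⁻¹, ?_⟩
      simp only at hx ⊢
      rw [← hstar, hx, star_star]
    · rintro ⟨x, rfl⟩
      refine ⟨x⁻¹, ?_⟩
      simp only
      rw [← hstar]
  set A := StarSubalgebra.centralizer ℂ (StarSubalgebra.centralizer ℂ s : Set (H →L[ℂ] H)) with hA
  have hmem : ∀ T : H →L[ℂ] H, (∀ S : H →L[ℂ] H, (∀ x, S * (U x : H →L[ℂ] H) = U x * S) →
      S * T = T * S) → T ∈ A := by
    intro T hT
    rw [hA, ← SetLike.mem_coe, StarSubalgebra.coe_centralizer_centralizer, hss, Set.union_self]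
    exact fun S hS => hT S fun x => (hS _ ⟨x, rfl⟩).symm
  let u : G → A := fun x => ⟨U x, hmem _ fun S hS => hS x⟩
  let t : C(G, ℂ) → A := fun f => ⟨integratedRep μ U hU f, hmem _ fun S hS =>
    integratedRep_commute μ U hU f S hS⟩
  have hu1 : u 1 = 1 := by ext1; simp [u]
  have humul : ∀ x y, u (x * y) = u x * u y := fun x y => by
    ext1
    change (U (x * y) : H →L[ℂ] H) = U x * U y
    rw [map_mul, Submonoid.coe_mul]
  obtain ⟨f, hf⟩ := exists_integratedRep_ne μ U hU ha
  have hz : (u a - 1) * t f ≠ 0 := fun h => hf (congrArg Subtype.val h)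
  obtain ⟨φ, hφ, hφn⟩ := exists_algHom_bicommutant_apply_ne_zero s hcomm hss hz
  rw [map_mul, map_sub, map_one] at hφ
  have htf : φ (t f) ≠ 0 := right_ne_zero_of_mul hφ
  have hua : φ (u a) ≠ 1 := sub_ne_zero.1 (left_ne_zero_of_mul hφ)
  have hun : ∀ x, ‖u x‖ ≤ 1 := fun x =>
    ContinuousLinearMap.opNorm_le_bound _ zero_le_one fun v => by
      rw [one_mul]; exact (Unitary.norm_map (U x) v).le
  have hle : ∀ x, ‖φ (u x)‖ ≤ 1 := fun x =>
    (hφn (u x)).trans (hun x)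
  have hinv : ∀ x, φ (u x) * φ (u x⁻¹) = 1 := fun x => by
    rw [← map_mul, ← humul, mul_inv_cancel, hu1, map_one]
  -- Both `φ (u x)` and its inverse `φ (u x⁻¹)` have norm at most one.
  have hone : ∀ x, ‖φ (u x)‖ = 1 := fun x => by
    refine le_antisymm (hle x) ?_
    have h1 : ‖φ (u x)‖ * ‖φ (u x⁻¹)‖ = 1 := by rw [← norm_mul, hinv, norm_one]
    nlinarith [hle x⁻¹, norm_nonneg (φ (u x))]
  let χ : G →* Circle :=
    { toFun := fun x => ⟨φ (u x), by simpa [Submonoid.unitSphere] using hone x⟩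
      map_one' := Subtype.ext ((congrArg φ hu1).trans (map_one φ))
      map_mul' := fun x y => Subtype.ext ((congrArg φ (humul x y)).trans (map_mul φ _ _)) }
  refine ⟨χ, ?_, fun h => hua (congrArg Subtype.val h)⟩
  refine Continuous.subtype_mk ?_ _
  -- `U` is only strongly continuous while `φ` is norm continuous. Dividing by `φ (t f) ≠ 0` moves
  -- the dependence on `x` into a translate of `f`, which varies continuously in the uniform norm.
  have h1 : ∀ x, φ (u x) = φ (t (translateMap f x)) / φ (t f) := fun x => by
    rw [eq_div_iff htf, ← map_mul]
    congr 1
    ext1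
    exact mul_integratedRep μ U hU f x
  simp_rw [h1]
  refine Continuous.div_const ?_ _
  have h2 : Continuous fun g : C(G, ℂ) => φ (t g) := by
    refine continuous_iff_continuousAt.2 fun g => ?_
    rw [ContinuousAt, tendsto_iff_norm_sub_tendsto_zero]
    have h3 : Tendsto (fun g' : C(G, ℂ) => ‖g' - g‖) (𝓝 g) (𝓝 0) :=
      tendsto_iff_norm_sub_tendsto_zero.1 tendsto_id
    refine squeeze_zero (fun _ => norm_nonneg _) (fun g' => ?_) h3
    rw [← map_sub]
    have h4 : t g' - t g = t (g' - g) := by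
      ext1
      exact (integratedRep_sub μ U hU g' g).symm
    rw [h4]
    have h5 : ‖t (g' - g)‖ ≤ ‖g' - g‖ := norm_integratedRep_le μ U hU (g' - g)
    exact (hφn _).trans h5
  exact h2.comp (translateMap f).continuous

end

/-! ### The regular representation, and characters separating points. -/

section
open MeasureTheory Filter Topology DomMulAct
open scoped ENNReal

/-- The regular representation of a compact abelian group on `L²`. -/
noncomputable def regularRep {G : Type*} [CommGroup G] [TopologicalSpace G] [IsTopologicalGroup G]
    [MeasurableSpace G] [BorelSpace G] (μ : Measure G) [μ.IsMulLeftInvariant] :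
    G →* unitary (Lp ℂ 2 μ →L[ℂ] Lp ℂ 2 μ) :=
  letI T : G → (Lp ℂ 2 μ ≃ₗᵢ[ℂ] Lp ℂ 2 μ) := fun x =>
    { toFun := fun g => mk x • g
      invFun := fun g => mk x⁻¹ • g
      map_add' := fun g h => smul_add _ _ _
      map_smul' := fun c g => smul_comm _ _ _
      left_inv := fun g => by simp [smul_smul]
      right_inv := fun g => by simp [smul_smul]
      norm_map' := fun g => norm_smul_Lp _ _ }
  { toFun := fun x => Unitary.linearIsometryEquiv.symm (T x)
    map_one' := by
      ext1; ext1 g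
      change mk (1 : G) • g = g
      simp
    map_mul' := fun x y => by
      ext1; ext1 g
      change mk (x * y) • g = mk x • mk y • g
      rw [smul_smul, ← mk_mul, mul_comm] }

theorem exists_character_ne_one {G : Type*} [CommGroup G] [TopologicalSpace G]
    [IsTopologicalGroup G] [CompactSpace G] [T2Space G] {a : G} (ha : a ≠ 1) :
    ∃ χ : G →* Circle, Continuous χ ∧ χ a ≠ 1 := by
  borelize G
  let μ : Measure G := Measure.haarMeasure ⊤
  have : IsProbabilityMeasure μ := ⟨by
    simpa using Measure.haarMeasure_self (K₀ := (⊤ : TopologicalSpace.PositiveCompacts G))⟩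
  have : Fact ((2 : ℝ≥0∞) ≠ ∞) := ⟨by simp⟩
  have hcont : ∀ v : Lp ℂ 2 μ, Continuous fun x =>
      (regularRep μ x : Lp ℂ 2 μ →L[ℂ] Lp ℂ 2 μ) v := fun v => by
    change Continuous fun x => DomMulAct.mk x • v
    exact (DomMulAct.continuous_mk.smul continuous_const)
  refine exists_character_ne_one_of_rep μ (regularRep μ) hcont fun h => ?_
  -- If `a` acted trivially, every continuous function would equal its translate by `a` almost
  -- everywhere, hence everywhere. A function separating `1` from `a` refutes this.
  obtain ⟨f, hf0, hf1, -⟩ := exists_continuous_zero_one_of_isClosed (isClosed_singleton (x := (1 : G)))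
    (isClosed_singleton (x := a)) (by simpa using ha.symm)
  let g : C(G, ℂ) := ⟨fun x => (f x : ℂ), by fun_prop⟩
  have hg : MemLp g 2 μ := g.continuous.memLp_of_hasCompactSupport
    (HasCompactSupport.of_compactSpace _)
  have h1 : DomMulAct.mk a • hg.toLp g = hg.toLp g := by
    have := congrArg (fun T : unitary (Lp ℂ 2 μ →L[ℂ] Lp ℂ 2 μ) =>
      (T : Lp ℂ 2 μ →L[ℂ] Lp ℂ 2 μ) (hg.toLp g)) h
    exact this
  rw [mk_smul_toLp, MemLp.toLp_eq_toLp_iff] at h1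
  have h2 := (Continuous.ae_eq_iff_eq μ (by fun_prop) g.continuous).1 h1
  have h3 := congrFun h2 1
  have e0 : f 1 = 0 := hf0 rfl
  have e1 : f a = 1 := hf1 rfl
  simp [g, e0, e1] at h3

end

/-! ### Finite subgroups of images, and the circle group. -/

section
open Topology Filter Set

theorem IsInductivelyMonothetic.commute {G : Type*} [Group G] [TopologicalSpace G]
    [IsTopologicalGroup G] [T2Space G] (hG : IsInductivelyMonothetic G) (a b : G) :
    a * b = b * a := by
  obtain ⟨g, hg⟩ := hG {a, b} (Set.toFinite _)
  have ha : a ∈ (Subgroup.zpowers g).topologicalClosure := hg ▸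
    Subgroup.le_topologicalClosure _ (Subgroup.subset_closure (by simp))
  have hb : b ∈ (Subgroup.zpowers g).topologicalClosure := hg ▸
    Subgroup.le_topologicalClosure _ (Subgroup.subset_closure (by simp))
  let := Subgroup.commGroupTopologicalClosure (Subgroup.zpowers g)
    (fun x y => Subtype.ext (setLike_mul_comm x.2 y.2))
  exact congrArg Subtype.val (mul_comm (⟨a, ha⟩ : (Subgroup.zpowers g).topologicalClosure) ⟨b, hb⟩)

theorem Subgroup.map_topologicalClosure_le_of_continuous {G H : Type*} [Group G]
    [TopologicalSpace G] [IsTopologicalGroup G] [Group H] [TopologicalSpace H]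
    [IsTopologicalGroup H] {f : G →* H} (hf : Continuous f) (S : Subgroup G) :
    S.topologicalClosure.map f ≤ (S.map f).topologicalClosure := by
  rintro _ ⟨x, hx, rfl⟩
  exact image_closure_subset_closure_image hf ⟨x, hx, rfl⟩

theorem Subgroup.topologicalClosure_eq_self {G : Type*} [Group G] [TopologicalSpace G]
    [IsTopologicalGroup G] {S : Subgroup G} (hS : IsClosed (S : Set G)) :
    S.topologicalClosure = S :=
  le_antisymm (S.topologicalClosure_minimal le_rfl hS) S.le_topologicalClosure

/-- A finite subgroup contained in the range of a continuous homomorphism from an inductively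
monothetic group is cyclic. -/
theorem IsInductivelyMonothetic.isCyclic_of_le_range {G H : Type*} [Group G]
    [TopologicalSpace G] [IsTopologicalGroup G] [Group H] [TopologicalSpace H]
    [IsTopologicalGroup H] [T2Space H] (hG : IsInductivelyMonothetic G) {f : G →* H}
    (hf : Continuous f) (S : Subgroup H) (hS : (S : Set H).Finite) (hSf : S ≤ f.range) :
    IsCyclic S := by
  have hc : ∀ T : Subgroup H, T ≤ S → T.topologicalClosure = T := fun T hT =>
    Subgroup.topologicalClosure_eq_self (hS.subset hT).isClosed
  obtain ⟨F, hFS, hF⟩ : ∃ F : Set G, f '' F = S ∧ F.Finite := by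
    choose! s hs using fun y (hy : y ∈ S) => hSf hy
    refine ⟨s '' S, ?_, hS.image s⟩
    rw [image_image]
    exact (image_congr hs).trans (image_id _)
  obtain ⟨g, hg⟩ := hG F hF
  have hmap : (Subgroup.closure F).map f = S := by
    rw [MonoidHom.map_closure, hFS, Subgroup.closure_eq]
  have hgS : f g ∈ S := by
    have h1 : g ∈ (Subgroup.closure F).topologicalClosure :=
      hg ▸ Subgroup.le_topologicalClosure _ (Subgroup.mem_zpowers g)
    have h2 := Subgroup.map_topologicalClosure_le_of_continuous hf _ ⟨g, h1, rfl⟩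
    rwa [hmap, hc S le_rfl] at h2
  have hle : Subgroup.zpowers (f g) ≤ S := by simpa using hgS
  have hge : S ≤ Subgroup.zpowers (f g) := by
    rw [← hmap]
    refine (Subgroup.map_mono (Subgroup.le_topologicalClosure _)).trans ?_
    rw [hg]
    refine (Subgroup.map_topologicalClosure_le_of_continuous hf _).trans ?_
    rw [MonoidHom.map_zpowers, hc _ hle]
  rw [le_antisymm hge hle]
  infer_instance

theorem Circle.exists_orderOf_eq (n : ℕ) (hn : n ≠ 0) : ∃ ζ : Circle, orderOf ζ = n := by
  have : Fact (0 < 2 * Real.pi) := ⟨by positivity⟩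
  have h := AddCircle.addOrderOf_period_div (p := 2 * Real.pi) (Nat.pos_of_ne_zero hn)
  set x : AddCircle (2 * Real.pi) := ((2 * Real.pi / n : ℝ) : AddCircle (2 * Real.pi))
  refine ⟨AddCircle.toCircle x, ?_⟩
  rw [← h, ← orderOf_ofAdd_eq_addOrderOf]
  exact orderOf_injective (AddCircle.toCircle_addChar (T := 2 * Real.pi)).toMonoidHom
    (AddCircle.injective_toCircle (by positivity)) (Multiplicative.ofAdd x)

/-- Since `χ` maps the kernel of `f` onto the circle, the image of `(f, χ)` contains `⟨f x⟩ × ⟨ζ⟩`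
for `ζ` of order `p`. This product is `(ℤ/p)²`, which is not cyclic. -/
theorem IsInductivelyMonothetic.false_of_prime_order {G A : Type*} [Group G]
    [TopologicalSpace G] [IsTopologicalGroup G] [Group A] [TopologicalSpace A]
    [IsTopologicalGroup A] [T2Space A] (hG : IsInductivelyMonothetic G) {f : G →* A}
    (hf : Continuous f) {χ : G →* Circle} (hχ : Continuous χ) {p : ℕ} (hp : p.Prime) {x : G}
    (hx : orderOf (f x) = p) (hsurj : ∀ z : Circle, ∃ k, f k = 1 ∧ χ k = z) : False := by
  obtain ⟨ζ, hζ⟩ := Circle.exists_orderOf_eq p hp.ne_zero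
  have hfin1 : ((Subgroup.zpowers (f x) : Subgroup A) : Set A).Finite := by
    rw [finite_zpowers, ← orderOf_pos_iff, hx]; exact hp.pos
  have hfin2 : ((Subgroup.zpowers ζ : Subgroup Circle) : Set Circle).Finite := by
    rw [finite_zpowers, ← orderOf_pos_iff, hζ]; exact hp.pos
  have h := hG.isCyclic_of_le_range (f := f.prod χ) (hf.prodMk hχ)
    ((Subgroup.zpowers (f x)).prod (Subgroup.zpowers ζ)) (by
      rw [Subgroup.coe_prod]; exact hfin1.prod hfin2) (by
      rintro ⟨a, z⟩ ⟨⟨i, hi⟩, -⟩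
      -- The element of the kernel of `f` corrects the value of `χ` without changing that of `f`.
      obtain ⟨k, hk1, hk2⟩ := hsurj ((χ x ^ i)⁻¹ * z)
      refine ⟨x ^ i * k, ?_⟩
      ext1
      · simpa [hk1] using hi
      · simp [hk2])
  have h2 : IsCyclic (Subgroup.zpowers (f x) × Subgroup.zpowers ζ) :=
    ((Subgroup.prodEquiv (Subgroup.zpowers (f x)) (Subgroup.zpowers ζ)).isCyclic).1 h
  have h3 := (Group.isCyclic_prod_iff.1 h2).2.2
  rw [Nat.card_zpowers, Nat.card_zpowers, hx, hζ, Nat.coprime_self] at h3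
  exact hp.one_lt.ne' h3

theorem Circle.exists_pow_eq_one_of_isClosed (S : Subgroup Circle)
    (hS : IsClosed (S : Set Circle)) (hne : S ≠ ⊤) : ∃ n : ℕ, n ≠ 0 ∧ ∀ z ∈ S, z ^ n = 1 := by
  have : Fact (0 < 2 * Real.pi) := ⟨by positivity⟩
  let e := AddCircle.homeomorphCircle (T := 2 * Real.pi) (by positivity)
  have he : ∀ x, e x = AddCircle.toCircle x := fun x => AddCircle.homeomorphCircle_apply _ x
  let s : AddSubgroup (AddCircle (2 * Real.pi)) :=
    { carrier := e ⁻¹' S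
      add_mem' := fun {a b} ha hb => by
        simp only [mem_preimage, he, AddCircle.toCircle_add, SetLike.mem_coe] at *
        exact S.mul_mem ha hb
      zero_mem' := by
        simp only [mem_preimage, he, AddCircle.toCircle_zero, SetLike.mem_coe]
        exact S.one_mem
      neg_mem' := fun {a} ha => by
        simp only [mem_preimage, he, AddCircle.toCircle_neg, SetLike.mem_coe] at *
        exact S.inv_mem ha }
  have hs : ¬ Dense (s : Set (AddCircle (2 * Real.pi))) := fun hd => by
    have hcl : IsClosed (s : Set (AddCircle (2 * Real.pi))) := hS.preimage e.continuous
    have h1 := hd.closure_eq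
    rw [hcl.closure_eq] at h1
    refine hne (eq_top_iff.2 fun z _ => ?_)
    have h2 : e.symm z ∈ (s : Set (AddCircle (2 * Real.pi))) := h1 ▸ mem_univ _
    simpa [s] using h2
  rw [AddCircle.dense_addSubgroup_iff_ne_zmultiples] at hs
  push Not at hs
  obtain ⟨a, ha, hsa⟩ := hs
  refine ⟨addOrderOf a, ha, fun z hz => ?_⟩
  have h2 : e.symm z ∈ s := by simpa [s] using hz
  rw [hsa] at h2
  obtain ⟨k, hk⟩ := h2
  have h3 : z = e (k • a) := by
    rw [show k • a = e.symm z from hk]; simp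
  rw [h3, he, AddCircle.toCircle_zsmul, ← zpow_natCast, ← zpow_mul, mul_comm k, zpow_mul,
    zpow_natCast, ← AddCircle.toCircle_nsmul, addOrderOf_nsmul_eq_zero, AddCircle.toCircle_zero,
    one_zpow]

theorem Circle.finite_zpow_eq {n : ℤ} (hn : n ≠ 0) (c : Circle) : {z : Circle | z ^ n = c}.Finite := by
  have key : ∀ (m : ℕ), m ≠ 0 → ∀ c : Circle, {z : Circle | z ^ m = c}.Finite := by
    intro m hm c
    have h1 : {z : ℂ | z ^ m = c}.Finite := by
      have := (Polynomial.nthRoots m (c : ℂ)).toFinset.finite_toSet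
      refine this.subset fun z hz => ?_
      simpa [Polynomial.mem_nthRoots (Nat.pos_of_ne_zero hm)] using hz
    refine (h1.preimage (Subtype.val_injective.injOn (s := univ).mono (subset_univ _))).subset
      fun z hz => ?_
    have : z ^ m = c := hz
    simp [← this]
  rcases n with m | m
  · simpa using key m (by simpa using hn) c
  · refine (key (m + 1) (by simp) c⁻¹).subset fun z hz => ?_
    have : z ^ (Int.negSucc m) = c := hz
    rw [zpow_negSucc] at this
    simp [← this]

/-- Countable subsets of a metric space are totally disconnected. -/
theorem eq_of_isPreconnected_of_finite {X Y : Type*} [TopologicalSpace X] [MetricSpace Y]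
    {f : X → Y} (hf : Continuous f) {t : Set X} (ht : IsPreconnected t) (hfin : (f '' t).Finite)
    {x y : X} (hx : x ∈ t) (hy : y ∈ t) : f x = f y :=
  hfin.countable.isTotallyDisconnected _ subset_rfl (ht.image f hf.continuousOn)
    (mem_image_of_mem f hx) (mem_image_of_mem f hy)

theorem Circle.eq_of_zpow_eq_on_preconnected {X : Type*} [TopologicalSpace X] {f : X → Circle}
    (hf : Continuous f) {t : Set X} (ht : IsPreconnected t) {n : ℤ} (hn : n ≠ 0) {c : Circle}
    (hc : ∀ x ∈ t, f x ^ n = c) {x y : X} (hx : x ∈ t) (hy : y ∈ t) : f x = f y :=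
  eq_of_isPreconnected_of_finite hf ht
    ((Circle.finite_zpow_eq hn c).subset (by rintro _ ⟨z, hz, rfl⟩; exact hc z hz)) hx hy

/-- Some Fourier coefficient of `φ` is nonzero, since otherwise its Fourier series would sum to `0`
at the identity, where `φ` is `1`. Translating the integral for that coefficient by `x` multiplies
it by `x ^ (-n) * φ x`, which must then be `1`. -/
theorem Circle.character_eq_zpow {φ : Circle →* Circle} (hφ : Continuous φ) :
    ∃ n : ℤ, ∀ z, φ z = z ^ n := by
  have : Fact (0 < 2 * Real.pi) := ⟨by positivity⟩
  let e := AddCircle.homeomorphCircle (T := 2 * Real.pi) (by positivity)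
  have he : ∀ x, e x = AddCircle.toCircle x := fun x => AddCircle.homeomorphCircle_apply _ x
  let f : C(AddCircle (2 * Real.pi), ℂ) := ⟨fun x => (φ (e x) : ℂ), by fun_prop⟩
  obtain ⟨n, hn⟩ : ∃ n, fourierCoeff f n ≠ 0 := by
    by_contra! h
    have h1 := has_pointwise_sum_fourier_series_of_summable (f := f) (by
      rw [show fourierCoeff f = 0 from funext h]; exact summable_zero) 0
    simp only [h, zero_smul] at h1
    have h2 := h1.unique hasSum_zero
    simp [f] at h2
  refine ⟨n, fun z => ?_⟩
  obtain ⟨x, rfl⟩ := e.surjective z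
  rw [fourierCoeff] at hn
  have h1 := MeasureTheory.integral_add_left_eq_self (μ := AddCircle.haarAddCircle)
    (fun t => fourier (-n) t • f t) x
  have h2 : ∀ t, fourier (-n) (x + t) • f (x + t)
      = (fourier (-n) x * f x) * (fourier (-n) t • f t) := fun t => by
    simp only [f, ContinuousMap.coe_mk, he, AddCircle.toCircle_add, map_mul, Circle.coe_mul,
      fourier_apply, smul_add, smul_eq_mul]
    ring
  simp_rw [h2] at h1
  rw [MeasureTheory.integral_const_mul] at h1
  have h3 : fourier (-n) x * f x = 1 := mul_right_cancel₀ hn (by rw [h1, one_mul])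
  have h4 : (e x ^ (-n) : Circle) * φ (e x) = 1 := by
    ext
    rw [fourier_apply, AddCircle.toCircle_zsmul, ← he] at h3
    simpa [f] using h3
  rw [zpow_neg, inv_mul_eq_one] at h4
  exact h4.symm
end

/-! ### Compact connected groups: rank one dual and dimension one. -/

section
open Topology Filter Set

theorem Circle.surjective_of_connected {K : Type*} [Group K] [TopologicalSpace K] 
    [CompactSpace K] [ConnectedSpace K] {χ : K →* Circle} (hχ : Continuous χ)
    (h1 : χ ≠ 1) : Function.Surjective χ := by
  rw [← MonoidHom.range_eq_top]
  by_contra hne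
  obtain ⟨n, hn, h⟩ := Circle.exists_pow_eq_one_of_isClosed χ.range (by
    rw [MonoidHom.coe_range]; exact (isCompact_range hχ).isClosed) hne
  apply h1
  ext1 x
  have := Circle.eq_of_zpow_eq_on_preconnected hχ (isPreconnected_univ (α := K)) (n := n)
    (by exact_mod_cast hn) (c := 1) (fun x _ => by simpa using h (χ x) ⟨x, rfl⟩)
    (mem_univ x) (mem_univ 1)
  simpa using this

theorem MonoidHom.eq_of_zpow_eq_of_connected {K : Type*} [Group K] [TopologicalSpace K]
    [ConnectedSpace K] {χ ψ : K →* Circle} (hχ : Continuous χ) (hψ : Continuous ψ) {n : ℤ}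
    (hn : n ≠ 0) (h : ∀ x, χ x ^ n = ψ x ^ n) (x : K) : χ x = ψ x := by
  have := Circle.eq_of_zpow_eq_on_preconnected (f := fun x => χ x / ψ x) (hχ.div' hψ)
    (isPreconnected_univ (α := K)) hn (c := 1) (fun x _ => by simp [div_zpow, h x])
    (mem_univ x) (mem_univ 1)
  simpa [div_eq_one] using this

section
variable {K : Type*} [CommGroup K] [TopologicalSpace K] [IsTopologicalGroup K] [CompactSpace K]
  [ConnectedSpace K]

/-- The dual has rank one. If `χ₂` maps the kernel of `χ₁` onto the circle, `false_of_prime_order`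
applies with `p = 2`. Otherwise that image is killed by some `n`, so `χ₂ ^ n` factors through `χ₁`
as a character of the circle, which is a power map. -/
theorem IsInductivelyMonothetic.exists_zpow_eq_zpow (hK : IsInductivelyMonothetic K)
    {χ₁ χ₂ : K →* Circle} (h₁ : Continuous χ₁) (h₂ : Continuous χ₂) (hne : χ₁ ≠ 1) :
    ∃ n m : ℤ, n ≠ 0 ∧ ∀ x, χ₂ x ^ n = χ₁ x ^ m := by
  have hs := Circle.surjective_of_connected h₁ hne
  have hN : IsClosed ((χ₁.ker.map χ₂ : Subgroup Circle) : Set Circle) := by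
    rw [Subgroup.coe_map]
    refine (IsClosed.isCompact ?_).image h₂ |>.isClosed
    exact (isClosed_singleton (x := (1 : Circle))).preimage h₁
  by_cases htop : χ₁.ker.map χ₂ = ⊤
  · exfalso
    obtain ⟨ζ, hζ⟩ := Circle.exists_orderOf_eq 2 two_ne_zero
    obtain ⟨x, rfl⟩ := hs ζ
    refine hK.false_of_prime_order h₁ h₂ Nat.prime_two hζ fun z => ?_
    have : z ∈ χ₁.ker.map χ₂ := htop ▸ Subgroup.mem_top z
    exact this
  · obtain ⟨n, hn, h⟩ := Circle.exists_pow_eq_one_of_isClosed _ hN htop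
    have hker : χ₁.ker ≤ (χ₂ ^ n).ker := fun x hx => by
      simpa [MonoidHom.mem_ker] using h (χ₂ x) ⟨x, hx, rfl⟩
    let φ : Circle →* Circle := χ₁.liftOfSurjective hs ⟨χ₂ ^ n, hker⟩
    have hφ : ∀ x, φ (χ₁ x) = χ₂ x ^ n := fun x => 
      MonoidHom.liftOfRightInverse_comp_apply χ₁ _ (Function.rightInverse_surjInv hs)
        ⟨χ₂ ^ n, hker⟩ x
    have hq : IsQuotientMap χ₁ := IsQuotientMap.of_surjective_continuous hs h₁
    have hφc : Continuous φ := by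
      rw [hq.continuous_iff]
      exact (h₂.pow n).congr fun x => (hφ x).symm
    obtain ⟨m, hm⟩ := Circle.character_eq_zpow hφc
    refine ⟨n, m, by exact_mod_cast hn, fun x => ?_⟩
    rw [← hm, hφ, zpow_natCast]

/-- Characters of a connected group are torsion-free, so the exponents in the dependence relation
may be taken coprime. With `n'u + m'v = 1`, the character `χ₁ ^ u * χ₂ ^ v` is a common root. -/
theorem IsInductivelyMonothetic.exists_common_root (hK : IsInductivelyMonothetic K)
    {χ₁ χ₂ : K →* Circle} (h₁ : Continuous χ₁) (h₂ : Continuous χ₂) (hne : χ₁ ≠ 1) :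
    ∃ ψ : K →* Circle, Continuous ψ ∧ ∃ a b : ℤ, ∀ x, χ₁ x = ψ x ^ a ∧ χ₂ x = ψ x ^ b := by
  obtain ⟨n, m, hn, h⟩ := hK.exists_zpow_eq_zpow h₁ h₂ hne
  obtain ⟨n', hn'⟩ := Int.gcd_dvd_left n m
  obtain ⟨m', hm'⟩ := Int.gcd_dvd_right n m
  have hd : (Int.gcd n m : ℤ) ≠ 0 := by
    intro h0; rw [h0, zero_mul] at hn'; exact hn hn'
  have hbez : (Int.gcd n m : ℤ) = n * n.gcdA m + m * n.gcdB m := Int.gcd_eq_gcd_ab n m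
  set u := n.gcdA m
  set v := n.gcdB m
  have hb : n' * u + m' * v = 1 := by
    apply mul_left_cancel₀ hd
    calc _ = ((Int.gcd n m : ℤ) * n') * u + ((Int.gcd n m : ℤ) * m') * v := by ring
      _ = _ := by rw [← hn', ← hm', mul_one, ← hbez]
  have h' : ∀ x, χ₂ x ^ n' = χ₁ x ^ m' := by
    have := MonoidHom.eq_of_zpow_eq_of_connected (χ := (zpowGroupHom n').comp χ₂)
      (ψ := (zpowGroupHom m').comp χ₁) (h₂.zpow n') (h₁.zpow m') hd (fun x => by
        simp only [MonoidHom.comp_apply, zpowGroupHom_apply]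
        rw [← zpow_mul, ← zpow_mul, mul_comm n', mul_comm m', ← hn', ← hm', h x])
    simpa using this
  refine ⟨(zpowGroupHom u).comp χ₁ * (zpowGroupHom v).comp χ₂, (h₁.zpow u).mul (h₂.zpow v),
    n', m', fun x => ⟨?_, ?_⟩⟩
  · simp only [MonoidHom.mul_apply, MonoidHom.comp_apply, zpowGroupHom_apply, mul_zpow]
    rw [← zpow_mul, ← zpow_mul, mul_comm v, zpow_mul (χ₂ x), h' x, ← zpow_mul, ← zpow_add,
      mul_comm u, hb, zpow_one]
  · simp only [MonoidHom.mul_apply, MonoidHom.comp_apply, zpowGroupHom_apply, mul_zpow]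
    rw [← zpow_mul, ← zpow_mul, mul_comm u, zpow_mul (χ₁ x), ← h' x, ← zpow_mul, ← zpow_add,
      mul_comm v, hb, zpow_one]

variable [T2Space K]

/-- Fibres of a nontrivial character are totally disconnected: every other character has a nonzero
power depending only on `χ`, so it is constant on `t`, and characters separate points. -/
theorem IsInductivelyMonothetic.eq_of_character_eq (hK : IsInductivelyMonothetic K)
    {χ : K →* Circle} (hχ : Continuous χ) (hne : χ ≠ 1) {t : Set K} (ht : IsPreconnected t)
    {x y : K} (hx : x ∈ t) (hy : y ∈ t) (hconst : ∀ z ∈ t, χ z = χ x) : x = y := by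
  by_contra hxy
  obtain ⟨ψ, hψ, hψne⟩ := exists_character_ne_one (a := x * y⁻¹)
    (by rwa [Ne, mul_inv_eq_one])
  obtain ⟨n, m, hn, h⟩ := hK.exists_zpow_eq_zpow hχ hψ hne
  refine hψne ?_
  rw [map_mul, map_inv, mul_inv_eq_one]
  exact Circle.eq_of_zpow_eq_on_preconnected hψ ht hn (c := χ x ^ m)
    (fun z hz => by rw [h, hconst z hz]) hx hy

theorem Circle.finite_dist_eq (c : Circle) (r : ℝ) : {z : Circle | dist z c = r}.Finite := by
  -- For `|w| = 1`, `|w - 1| = r` means `2 - 2 Re w = r²`.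
  have hfin : {w : ℂ | w.re = 1 - r ^ 2 / 2 ∧ w.im ^ 2 = 1 - (1 - r ^ 2 / 2) ^ 2}.Finite := by
    set a := 1 - r ^ 2 / 2
    refine (Set.toFinite {(⟨a, √(1 - a ^ 2)⟩ : ℂ), ⟨a, -√(1 - a ^ 2)⟩}).subset fun w hw => ?_
    obtain ⟨h1, h2⟩ := hw
    have h3 : √(1 - a ^ 2) = |w.im| := by rw [← h2, Real.sqrt_sq_eq_abs]
    rcases abs_choice w.im with h | h
    · left; apply Complex.ext <;> simp [h1, h3, h]
    · right; simp only [mem_singleton_iff]; apply Complex.ext <;> simp [h1, h3, h]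
  refine (hfin.preimage (f := fun z : Circle => ((z * c⁻¹ : Circle) : ℂ)) ?_).subset ?_
  · intro a _ b _ h
    exact mul_right_cancel (Circle.ext h)
  · intro z hz
    have hz' : dist z c = r := hz
    have h1 : ‖((z * c⁻¹ : Circle) : ℂ) - 1‖ = r := by
      rw [← hz', show dist z c = dist (z : ℂ) c from rfl, dist_eq_norm, ← one_mul ‖_ - 1‖, ← Circle.norm_coe c, ← norm_mul]
      congr 1
      rw [mul_sub, ← Circle.coe_mul]
      simp
    set w := ((z * c⁻¹ : Circle) : ℂ) with hw
    have h2 : w.re ^ 2 + w.im ^ 2 = 1 := by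
      have := Circle.normSq_coe (z * c⁻¹)
      rw [Complex.normSq_apply] at this
      nlinarith
    have h3 : (w.re - 1) ^ 2 + w.im ^ 2 = r ^ 2 := by
      rw [← h1, Complex.sq_norm, Complex.normSq_apply]
      simp; ring
    have h4 : w.re = 1 - r ^ 2 / 2 := by nlinarith
    refine ⟨h4, ?_⟩
    rw [← h4]; linarith

/-- The fibres through `x` of nontrivial characters intersect in `{x}` and are directed downwards by
`exists_common_root`. Compactness puts one of them inside `U`. -/
theorem IsInductivelyMonothetic.exists_character_separating [Nontrivial K]
    (hK : IsInductivelyMonothetic K) {U : Set K} (hU : IsOpen U) {x : K} (hx : x ∈ U) :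
    ∃ χ : K →* Circle, Continuous χ ∧ χ ≠ 1 ∧ ∀ y, χ y = χ x → y ∈ U := by
  let ι := {χ : K →* Circle // Continuous χ ∧ χ ≠ 1}
  have hsep : ∀ y : K, y ≠ x → ∃ χ : ι, χ.1 y ≠ χ.1 x := fun y hy => by
    obtain ⟨ψ, hψ, hne⟩ := exists_character_ne_one (a := y * x⁻¹) (by rwa [Ne, mul_inv_eq_one])
    refine ⟨⟨ψ, hψ, fun h => hne (by simp [h])⟩, fun h => hne ?_⟩
    simpa [mul_inv_eq_one] using h
  obtain ⟨y0, hy0⟩ := exists_ne x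
  have : Nonempty ι := ⟨(hsep y0 hy0).choose⟩
  let C : ι → Set K := fun χ => {y | χ.1 y = χ.1 x}
  have hdir : Directed (· ⊇ ·) C := by
    rintro ⟨χ₁, h₁, hn₁⟩ ⟨χ₂, h₂, hn₂⟩
    obtain ⟨ψ, hψ, a, b, hab⟩ := hK.exists_common_root h₁ h₂ hn₁
    refine ⟨⟨ψ, hψ, fun h => hn₁ ?_⟩, fun y hy => ?_, fun y hy => ?_⟩
    · ext1 z
      simp [(hab z).1, h]
    · have hy' : ψ y = ψ x := hy
      simp [C, (hab _).1, hy']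
    · have hy' : ψ y = ψ x := hy
      simp [C, (hab _).2, hy']
  obtain ⟨χ, hχ⟩ := (hU.isClosed_compl.isCompact).elim_directed_family_closed C
    (fun χ => isClosed_eq χ.2.1 continuous_const) (by
      rw [Set.eq_empty_iff_forall_notMem]
      rintro y ⟨hy, hy2⟩
      rw [mem_iInter] at hy2
      by_cases hyx : y = x
      · exact hy (hyx ▸ hx)
      · obtain ⟨χ, hχ⟩ := hsep y hyx
        exact hχ (hy2 χ)) hdir
  refine ⟨χ.1, χ.2.1, χ.2.2, fun y hy => ?_⟩
  by_contra hyU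
  exact (Set.eq_empty_iff_forall_notMem.1 hχ) y ⟨hyU, hy⟩

/-- A nontrivial compact connected inductively monothetic abelian group is one-dimensional. -/
theorem IsInductivelyMonothetic.smallInductiveDimension_eq_one [Nontrivial K]
    (hK : IsInductivelyMonothetic K) : smallInductiveDimension K = 1 := by
  refine smallInductiveDimension_eq 1 ?_ fun h => ?_
  · let s : Set (Set K) := {V | ∃ χ : K →* Circle, Continuous χ ∧ χ ≠ 1 ∧ ∃ (c : Circle) (r : ℝ),
      V = {y | dist (χ y) c < r}}
    -- Frontiers must be `LT 1`, which means having a basis of clopen sets. The frontier of the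
    -- preimage of an arc lies over finitely many points of the circle, hence is compact and totally
    -- disconnected.
    refine .succ 1 s ?_ ?_
    · refine TopologicalSpace.isTopologicalBasis_of_isOpen_of_nhds ?_ ?_
      · rintro _ ⟨χ, hχ, -, c, r, rfl⟩
        exact isOpen_lt (hχ.dist continuous_const) continuous_const
      · intro x U hx hU
        obtain ⟨χ, hχ, hne, h⟩ := hK.exists_character_separating hU hx
        have hcl : IsClosed (χ '' Uᶜ) := (hU.isClosed_compl.isCompact.image hχ).isClosed
        have hmem : χ x ∈ (χ '' Uᶜ)ᶜ := by
          rintro ⟨y, hy, hyx⟩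
          exact hy (h y hyx)
        obtain ⟨r, hr, hball⟩ := Metric.isOpen_iff.1 hcl.isOpen_compl _ hmem
        refine ⟨_, ⟨χ, hχ, hne, χ x, r, rfl⟩, by simpa using hr, fun y hy => ?_⟩
        by_contra hyU
        exact hball hy ⟨y, hyU, rfl⟩
    · rintro _ ⟨χ, hχ, hne, c, r, rfl⟩
      have hfr : frontier {y | dist (χ y) c < r} ⊆ {y | dist (χ y) c = r} :=
        frontier_lt_subset_eq (hχ.dist continuous_const) continuous_const
      rw [hasSmallInductiveDimensionLT_one_iff]
      have : CompactSpace (frontier {y | dist (χ y) c < r}) :=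
        isCompact_iff_compactSpace.1 isClosed_frontier.isCompact
      have : TotallyDisconnectedSpace (frontier {y | dist (χ y) c < r}) := by
        rw [totallyDisconnectedSpace_subtype_iff]
        intro t htf ht x hx y hy
        refine hK.eq_of_character_eq hχ hne ht hx hy fun z hz => ?_
        refine eq_of_isPreconnected_of_finite hχ ht ?_ hz hx
        refine (Circle.finite_dist_eq c r).subset ?_
        rintro _ ⟨w, hw, rfl⟩
        exact hfr (htf hw)
      exact isTopologicalBasis_isClopen
  · rw [hasSmallInductiveDimensionLT_one_iff] at h
    obtain ⟨x, y, hxy⟩ := exists_pair_ne K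
    obtain ⟨V, hV, hxV, hVy⟩ := h.exists_subset_of_mem_open (u := {y}ᶜ) (a := x) hxy
      isOpen_compl_singleton
    have := (isClopen_iff.1 hV).resolve_left (fun h => by simp [h] at hxV)
    exact hVy (this ▸ mem_univ y) rfl
end
end

/-! ### Noncompact elements, and compact open subgroups. -/

section
open Topology Filter Set
open scoped Pointwise

theorem Subgroup.mem_topologicalClosure_iff_map_subtype {G : Type*} [Group G] [TopologicalSpace G]
    [IsTopologicalGroup G] {S : Subgroup G} {T : Subgroup S} {x : S} :
    x ∈ T.topologicalClosure ↔ (x : G) ∈ (T.map S.subtype).topologicalClosure := by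
  rw [← SetLike.mem_coe, ← SetLike.mem_coe, Subgroup.topologicalClosure_coe,
    Subgroup.topologicalClosure_coe, Subgroup.coe_map]
  exact closure_subtype

theorem IsInductivelyMonothetic.subgroup {G : Type*} [Group G] [TopologicalSpace G]
    [IsTopologicalGroup G] (hG : IsInductivelyMonothetic G) {S : Subgroup G}
    (hS : IsClosed (S : Set G)) : IsInductivelyMonothetic S := by
  intro F hF
  obtain ⟨g, hg⟩ := hG (S.subtype '' F) (hF.image _)
  have hgS : g ∈ S := by
    have h1 : g ∈ (Subgroup.closure (S.subtype '' F)).topologicalClosure :=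
      hg ▸ Subgroup.le_topologicalClosure _ (Subgroup.mem_zpowers g)
    refine Subgroup.topologicalClosure_minimal _ ?_ hS h1
    rw [Subgroup.closure_le]
    rintro _ ⟨y, -, rfl⟩
    exact y.2
  refine ⟨⟨g, hgS⟩, ?_⟩
  ext x
  rw [Subgroup.mem_topologicalClosure_iff_map_subtype,
    Subgroup.mem_topologicalClosure_iff_map_subtype, MonoidHom.map_closure, hg,
    MonoidHom.map_zpowers]
  rfl

/-- By Baire some singleton has nonempty interior, and translation does the rest. -/
theorem discreteTopology_of_countable_of_baire (G : Type*) [Group G] [TopologicalSpace G]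
    [IsTopologicalGroup G] [Countable G] [BaireSpace G] [T1Space G] : DiscreteTopology G := by
  obtain ⟨x, hx⟩ := nonempty_interior_of_iUnion_of_closed (f := fun x : G => {x})
    (fun x => isClosed_singleton) (by ext; simp)
  obtain ⟨y, hy⟩ := hx
  have h1 : y ∈ ({x} : Set G) := interior_subset hy
  rw [mem_singleton_iff] at h1
  subst h1
  have h2 : IsOpen ({y} : Set G) := by
    convert isOpen_interior (s := ({y} : Set G))
    exact Subset.antisymm (singleton_subset_iff.2 hy) interior_subset
  refine discreteTopology_of_isOpen_singleton_one ?_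
  convert h2.preimage (continuous_const_mul y)
  ext z
  simp

section
variable {G : Type*} [CommGroup G] [TopologicalSpace G] [IsTopologicalGroup G]
  [LocallyCompactSpace G]

/-- In a locally compact abelian group, an element topologically generates either a compact group
or an infinite discrete group. -/
theorem isCompact_topologicalClosure_zpowers_or_discrete (g : G) :
    IsCompact ((Subgroup.zpowers g).topologicalClosure : Set G) ∨
      ∃ V ∈ 𝓝 (1 : G), ∀ n : ℤ, n ≠ 0 → g ^ n ∉ V := by
  rw [or_iff_not_imp_right]
  intro h
  push Not at h
  -- A nonzero power of `g` close enough to `1` can be raised to the power `±N` without leaving `V`.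
  have hlarge : ∀ V ∈ 𝓝 (1 : G), ∀ N : ℕ, ∃ n : ℕ, N ≤ n ∧ g ^ (n : ℤ) ∈ V := by
    intro V hV N
    have hpow : Tendsto (fun x : G => x ^ N) (𝓝 1) (𝓝 1) := by
      simpa using (continuous_pow (M := G) N).tendsto 1
    have hinv : Tendsto (fun x : G => (x⁻¹) ^ N) (𝓝 1) (𝓝 1) := by
      simpa using (by fun_prop : Continuous fun x : G => (x⁻¹) ^ N).tendsto 1
    obtain ⟨n, hn, h1, h2⟩ := h _ (inter_mem (hpow hV) (hinv hV))
    refine ⟨n.natAbs * N, Nat.le_mul_of_pos_left _ (Int.natAbs_pos.2 hn), ?_⟩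
    rcases Int.natAbs_eq n with h3 | h3
    · push_cast
      rw [zpow_mul, zpow_natCast]
      rw [h3] at h1
      simpa using h1
    · push_cast
      rw [zpow_mul, zpow_natCast]
      rw [h3] at h2
      simpa using h2
  obtain ⟨K, hK, hK1⟩ := exists_compact_mem_nhds (1 : G)
  set V := interior K with hV
  have hVo : IsOpen V := isOpen_interior
  have h1V : (1 : G) ∈ V := mem_interior_iff_mem_nhds.2 hK1
  set M := (Subgroup.zpowers g).topologicalClosure with hM
  have hMc : IsClosed (M : Set G) := Subgroup.isClosed_topologicalClosure _
  have hgM : ∀ n : ℤ, g ^ n ∈ M := fun n =>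
    Subgroup.le_topologicalClosure _ (Subgroup.zpow_mem_zpowers g n)
  have hmeet : ∀ x ∈ M, ∃ k : ℤ, g ^ k * x ∈ V := by
    intro x hx
    have ho : IsOpen {y : G | y⁻¹ * x ∈ V} := hVo.preimage (by fun_prop)
    obtain ⟨y, hy, k, rfl⟩ := mem_closure_iff.1 hx _ ho (by simpa using h1V)
    exact ⟨-k, by simpa using hy⟩
  have hpos : ∀ x ∈ M, ∃ n : ℕ, 0 < n ∧ g ^ (n : ℤ) * x ∈ V := by
    intro x hx
    obtain ⟨k, hk⟩ := hmeet x hx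
    have ho : IsOpen {v : G | v * (g ^ k * x) ∈ V} := hVo.preimage (by fun_prop)
    obtain ⟨m, hm, hmV⟩ := hlarge _ (ho.mem_nhds (by simpa using hk)) (k.natAbs + 1)
    refine ⟨(m + k).toNat, by omega, ?_⟩
    rw [Int.toNat_of_nonneg (by omega), zpow_add, mul_assoc]
    exact hmV
  have hneg : ∀ x ∈ M, ∃ n : ℕ, g ^ (-(n : ℤ)) * x ∈ V := by
    intro x hx
    obtain ⟨k, hk⟩ := hmeet x hx
    have ho : IsOpen {v : G | v⁻¹ * (g ^ k * x) ∈ V} := hVo.preimage (by fun_prop)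
    obtain ⟨m, hm, hmV⟩ := hlarge _ (ho.mem_nhds (by simpa using hk)) (k.natAbs + 1)
    refine ⟨(m - k).toNat, ?_⟩
    rw [Int.toNat_of_nonneg (by omega), neg_sub, sub_eq_add_neg, add_comm, zpow_add, mul_assoc,
      zpow_neg]
    exact hmV
  obtain ⟨t, ht⟩ := (hK.inter_right hMc).elim_finite_subcover
    (fun n : {n : ℕ // 0 < n} => {x : G | g ^ (n.1 : ℤ) * x ∈ V})
    (fun n => hVo.preimage (by fun_prop)) (fun x hx => by
      obtain ⟨n, hn, hnV⟩ := hpos x hx.2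
      exact mem_iUnion.2 ⟨⟨n, hn⟩, hnV⟩)
  set N := t.sup (fun n => n.1)
  -- Points of the compact set `K ∩ M` enter `V` under a positive power of `g` with exponent at most
  -- `N`. Taking the least `n` with `g ^ (-n) * x ∈ V` forces `n < N`, since a return in `i ≤ n`
  -- steps would give the smaller exponent `n - i`.
  have hsub : (M : Set G) ⊆ ⋃ n ∈ Finset.range (N + 1), (fun y => g ^ n * y) '' K := by
    intro x hx
    classical
    have hex := hneg x hx
    set n := Nat.find hex
    have hn : g ^ (-(n : ℤ)) * x ∈ V := Nat.find_spec hex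
    have hnM : g ^ (-(n : ℤ)) * x ∈ M := M.mul_mem (hgM _) hx
    obtain ⟨i, hit, hi⟩ := mem_iUnion₂.1 (ht ⟨interior_subset hn, hnM⟩)
    have hiN : i.1 ≤ N := Finset.le_sup (f := fun n : {n : ℕ // 0 < n} => n.1) hit
    have hni : n < i.1 := by
      by_contra! hle
      refine Nat.find_min hex (m := n - i.1) (by have := i.2; omega) ?_
      have hi' : g ^ (i.1 : ℤ) * (g ^ (-(n : ℤ)) * x) ∈ V := hi
      rw [← mul_assoc, ← zpow_add] at hi'
      convert hi' using 3
      push_cast [hle]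
      ring
    refine mem_iUnion₂.2 ⟨n, Finset.mem_range.2 (by omega), _, interior_subset hn, ?_⟩
    simp
  refine IsCompact.of_isClosed_subset ?_ hMc hsub
  exact (Finset.range (N + 1)).isCompact_biUnion fun n _ => hK.image (continuous_const_mul _)

variable [T2Space G]

omit [T2Space G] in
theorem zpow_eq_one_iff_of_not_isCompact {g : G}
    (hg : ¬ IsCompact ((Subgroup.zpowers g).topologicalClosure : Set G)) {n : ℤ} :
    g ^ n = 1 ↔ n = 0 := by
  refine ⟨fun h => ?_, fun h => by simp [h]⟩
  obtain ⟨V, hV, h2⟩ := (isCompact_topologicalClosure_zpowers_or_discrete g).resolve_left hg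
  by_contra hn
  exact h2 n hn (h ▸ mem_of_mem_nhds hV)

theorem isClosed_zpowers_of_not_isCompact {g : G}
    (hg : ¬ IsCompact ((Subgroup.zpowers g).topologicalClosure : Set G)) :
    IsClosed (Subgroup.zpowers g : Set G) := by
  obtain ⟨V, hV, h2⟩ := (isCompact_topologicalClosure_zpowers_or_discrete g).resolve_left hg
  have : DiscreteTopology (Subgroup.zpowers g) := by
    refine discreteTopology_of_isOpen_singleton_one ?_
    convert (isOpen_interior (s := V)).preimage (continuous_subtype_val (p := (· ∈ Subgroup.zpowers g)))
    ext ⟨x, n, hn⟩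
    simp only [mem_singleton_iff, mem_preimage]
    refine ⟨fun h => ?_, fun h => ?_⟩
    · rw [Subtype.ext_iff] at h
      change x = 1 at h
      rw [h]; exact mem_interior_iff_mem_nhds.2 hV
    · by_contra hne
      refine h2 n ?_ (interior_subset (by rw [show g ^ n = x from hn]; exact h))
      rintro rfl
      exact hne (Subtype.ext (by simpa using hn.symm))
  exact Subgroup.isClosed_of_discrete

/-- A topological generator `k` for `{g, h}` cannot generate a relatively compact group, as `g` does
not. So the group of powers of `k` is already closed, and `g` and `h` are honest powers of `k`. -/
theorem IsInductivelyMonothetic.exists_zpow_generator (hG : IsInductivelyMonothetic G) {g : G}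
    (hg : ¬ IsCompact ((Subgroup.zpowers g).topologicalClosure : Set G)) (h : G) :
    ∃ k : G, (∀ n : ℤ, k ^ n = 1 ↔ n = 0) ∧ ∃ a b : ℤ, a ≠ 0 ∧ g = k ^ a ∧ h = k ^ b := by
  obtain ⟨k, hk⟩ := hG {g, h} (toFinite _)
  have hgk : g ∈ (Subgroup.zpowers k).topologicalClosure := hk ▸
    Subgroup.le_topologicalClosure _ (Subgroup.subset_closure (by simp))
  have hhk : h ∈ (Subgroup.zpowers k).topologicalClosure := hk ▸
    Subgroup.le_topologicalClosure _ (Subgroup.subset_closure (by simp))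
  have hkc : ¬ IsCompact ((Subgroup.zpowers k).topologicalClosure : Set G) := fun hc => by
    refine hg (hc.of_isClosed_subset (Subgroup.isClosed_topologicalClosure _) ?_)
    refine Subgroup.topologicalClosure_minimal _ ?_ (Subgroup.isClosed_topologicalClosure _)
    simpa using hgk
  rw [Subgroup.topologicalClosure_eq_self (isClosed_zpowers_of_not_isCompact hkc)] at hgk hhk
  obtain ⟨a, ha⟩ := hgk
  obtain ⟨b, hb⟩ := hhk
  refine ⟨k, fun n => zpow_eq_one_iff_of_not_isCompact hkc, a, b, ?_, ha.symm, hb.symm⟩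
  rintro rfl
  have : g = 1 := by simpa using ha.symm
  have h1 := (zpow_eq_one_iff_of_not_isCompact hg (n := 1)).1 (by simp [this])
  exact one_ne_zero h1

/-- If some element does not topologically generate a compact group, then an inductively
monothetic locally compact group is a discrete subgroup of `ℚ`. -/
theorem IsInductivelyMonothetic.discrete_rational (hG : IsInductivelyMonothetic G) {g : G}
    (hg : ¬ IsCompact ((Subgroup.zpowers g).topologicalClosure : Set G)) :
    DiscreteTopology G ∧ ∃ H : AddSubgroup ℚ, Nonempty (G ≃* Multiplicative H) := by
  have hex : ∀ h : G, ∃ a b : ℤ, a ≠ 0 ∧ h ^ a = g ^ b := fun h => by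
    obtain ⟨k, -, a, b, ha, hga, hhb⟩ := hG.exists_zpow_generator hg h
    refine ⟨a, b, ha, ?_⟩
    rw [hga, hhb, ← zpow_mul, ← zpow_mul, mul_comm]
  have htf : ∀ (h : G) (n : ℤ), n ≠ 0 → h ^ n = 1 → h = 1 := fun h n hn h1 => by
    obtain ⟨k, hk, a, b, ha, hga, hhb⟩ := hG.exists_zpow_generator hg h
    rw [hhb, ← zpow_mul, hk, mul_eq_zero] at h1
    simp [hhb, h1.resolve_right hn]
  have hg1 : ∀ n m : ℤ, g ^ n = g ^ m → n = m := fun n m hnm => by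
    rw [← sub_eq_zero, ← zpow_eq_one_iff_of_not_isCompact hg, zpow_sub, hnm, mul_inv_cancel]
  choose a b ha hab using hex
  have huniq : ∀ (h : G) (n m : ℤ), n ≠ 0 → h ^ n = g ^ m → (b h : ℚ) / a h = m / n := by
    intro h n m hn hnm
    rw [div_eq_div_iff (by exact_mod_cast ha h) (by exact_mod_cast hn)]
    have : g ^ (b h * n) = g ^ (m * a h) := by
      rw [zpow_mul, ← hab, zpow_mul, ← hnm, ← zpow_mul, ← zpow_mul, mul_comm]
    exact_mod_cast hg1 _ _ this
  -- The logarithm to base `g`: a relation `h ^ a = g ^ b` gives the value `b / a`, independently of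
  -- the relation by `huniq`.
  let φ : Additive G →+ ℚ := AddMonoidHom.mk' (fun x => (b x.toMul : ℚ) / a x.toMul) (by
    intro x y
    rw [huniq (x + y).toMul (a x.toMul * a y.toMul)
      (b x.toMul * a y.toMul + b y.toMul * a x.toMul) (mul_ne_zero (ha _) (ha _))]
    · have h1 : (a x.toMul : ℚ) ≠ 0 := by exact_mod_cast ha _
      have h2 : (a y.toMul : ℚ) ≠ 0 := by exact_mod_cast ha _
      push_cast
      field_simp
    · rw [toMul_add, mul_zpow, zpow_mul, hab, mul_comm (a x.toMul), zpow_mul, hab, zpow_add,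
        zpow_mul, zpow_mul])
  have hφ : Function.Injective φ := by
    rw [injective_iff_map_eq_zero]
    intro x hx
    have h1 : (b x.toMul : ℚ) / a x.toMul = 0 := hx
    rw [div_eq_zero_iff] at h1
    have h2 : b x.toMul = 0 := by
      have := h1.resolve_right (by exact_mod_cast ha x.toMul)
      exact_mod_cast this
    have h3 := hab x.toMul
    rw [h2, zpow_zero] at h3
    exact htf _ _ (ha _) h3
  refine ⟨?_, φ.range, ⟨?_⟩⟩
  · have : Countable G := (hφ.comp Additive.ofMul.injective).countable
    exact discreteTopology_of_countable_of_baire G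
  · exact AddEquiv.toMultiplicativeRight (AddMonoidHom.ofInjective hφ)

omit [T2Space G] in
/-- In an inductively monothetic locally compact group all of whose elements topologically
generate compact groups, every compact set lies in a compact open subgroup. -/
theorem IsInductivelyMonothetic.exists_isCompact_isOpen_subgroup (hG : IsInductivelyMonothetic G)
    (hc : ∀ g : G, IsCompact ((Subgroup.zpowers g).topologicalClosure : Set G))
    {C : Set G} (hC : IsCompact C) :
    ∃ L : Subgroup G, C ⊆ L ∧ IsCompact (L : Set G) ∧ IsOpen (L : Set G) := by
  obtain ⟨K, hK, hK1⟩ := exists_compact_mem_nhds (1 : G)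
  set W := K ∪ C
  have hW : IsCompact W := hK.union hC
  set V := W ∪ W⁻¹ with hVdef
  have hV : IsCompact V := hW.union hW.inv
  have hVinv : V⁻¹ = V := by rw [hVdef, union_inv, inv_inv, union_comm]
  have hKV : K ⊆ V := subset_union_left.trans subset_union_left
  -- Finitely many translates of `K ⊆ V` cover `V * V`. The closed subgroup `L₀` generated by the
  -- translating elements is compact by hypothesis, and `V * V ⊆ V * L₀` makes `V * L₀` a subgroup.
  obtain ⟨F, hF⟩ := (hV.mul hV).elim_finite_subcover (fun f : G => {x | f⁻¹ * x ∈ interior K})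
    (fun f => isOpen_interior.preimage (by fun_prop)) (fun x _ => mem_iUnion.2 ⟨x, by
      simpa using mem_interior_iff_mem_nhds.2 hK1⟩)
  obtain ⟨k, hk⟩ := hG F F.finite_toSet
  set L₀ := (Subgroup.closure (F : Set G)).topologicalClosure with hL₀
  have hL₀c : IsCompact (L₀ : Set G) := hk ▸ hc k
  have hFL : ∀ f ∈ F, f ∈ L₀ := fun f hf =>
    Subgroup.le_topologicalClosure _ (Subgroup.subset_closure hf)
  have hVV : ∀ x ∈ V, ∀ y ∈ V, ∃ v ∈ V, ∃ l ∈ L₀, x * y = v * l := by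
    intro x hx y hy
    obtain ⟨f, hf, hfx⟩ := mem_iUnion₂.1 (hF (mul_mem_mul hx hy))
    have hfx' : f⁻¹ * (x * y) ∈ interior K := hfx
    refine ⟨_, hKV (interior_subset hfx'), f, hFL f hf, ?_⟩
    rw [mul_comm _ f, mul_inv_cancel_left]
  let L : Subgroup G :=
    { carrier := V * L₀
      mul_mem' := by
        rintro _ _ ⟨v, hv, l, hl, rfl⟩ ⟨v', hv', l', hl', rfl⟩
        obtain ⟨w, hw, m, hm, h⟩ := hVV v hv v' hv'
        refine ⟨w, hw, m * (l * l'), L₀.mul_mem hm (L₀.mul_mem hl hl'), ?_⟩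
        simp only
        rw [← mul_assoc, ← h, mul_mul_mul_comm]
      one_mem' := ⟨1, hKV (mem_of_mem_nhds hK1), 1, L₀.one_mem, by simp⟩
      inv_mem' := by
        rintro _ ⟨v, hv, l, hl, rfl⟩
        refine ⟨v⁻¹, ?_, l⁻¹, L₀.inv_mem hl, ?_⟩
        · rw [← hVinv]; simpa using hv
        · simp [mul_comm] }
  have hVL : V ⊆ (L : Set G) := fun v hv => ⟨v, hv, 1, L₀.one_mem, by simp⟩
  exact ⟨L, (subset_union_right.trans subset_union_left).trans hVL, hV.mul hL₀c,
    L.isOpen_of_mem_nhds (mem_of_superset hK1 (hKV.trans hVL))⟩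

end

/-! ### Totally disconnected or compact connected. -/

theorem exists_ne_mem_isPreconnected_of_not_totallyDisconnected {G : Type*} [Group G]
    [TopologicalSpace G] [IsTopologicalGroup G] (h : ¬ TotallyDisconnectedSpace G) :
    ∃ y ∈ connectedComponent (1 : G), y ≠ 1 := by
  by_contra! h1
  refine h ⟨fun t _ ht x hx y hy => ?_⟩
  have h2 : IsPreconnected ((fun z => x⁻¹ * z) '' t) :=
    ht.image _ (continuous_const_mul _).continuousOn
  have h3 := h2.subset_connectedComponent (x := 1) ⟨x, hx, by simp⟩ ⟨y, hy, rfl⟩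
  have h4 := h1 _ h3
  exact (inv_mul_eq_one.1 h4)

/-- If `K` is neither, some proper open subgroup `U` contains the nontrivial identity component. A
character maps that component onto the circle, while the finite group `K ⧸ U` has an element of
prime order, against `false_of_prime_order`. -/
theorem IsInductivelyMonothetic.totallyDisconnected_or_connected_of_compact {K : Type*}
    [CommGroup K] [TopologicalSpace K] [IsTopologicalGroup K] [CompactSpace K] [T2Space K]
    (hK : IsInductivelyMonothetic K) : TotallyDisconnectedSpace K ∨ ConnectedSpace K := by
  rw [or_iff_not_imp_left]
  intro htd
  obtain ⟨y, hy, hy1⟩ := exists_ne_mem_isPreconnected_of_not_totallyDisconnected htd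
  rw [connectedSpace_iff_connectedComponent]
  refine ⟨1, ?_⟩
  by_contra hne
  obtain ⟨x, hx⟩ := (ne_univ_iff_exists_notMem _).1 hne
  rw [connectedComponent_eq_iInter_isClopen, mem_iInter, not_forall] at hx
  obtain ⟨⟨W, hW, h1W⟩, hxW⟩ := hx
  obtain ⟨U, hU⟩ := IsTopologicalGroup.exist_openSubgroup_sub_clopen_nhds_of_one hW h1W
  have hxU : x ∉ (U : Subgroup K) := fun h => hxW (hU h)
  have hUo : IsOpen ((U : Subgroup K) : Set K) := U.isOpen
  have : DiscreteTopology (K ⧸ (U : Subgroup K)) := QuotientGroup.discreteTopology hUo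
  have : Finite (K ⧸ (U : Subgroup K)) := finite_of_compact_of_discrete
  obtain ⟨χ, hχ, hχy⟩ := exists_character_ne_one hy1
  set C := Subgroup.connectedComponentOfOne K
  have hCU : (C : Set K) ⊆ (U : Subgroup K) :=
    isPreconnected_connectedComponent.subset_isClopen ⟨Subgroup.isClosed_of_isOpen _ hUo, hUo⟩
      ⟨1, mem_connectedComponent, (U : Subgroup K).one_mem⟩
  have hCc : CompactSpace C :=
    isCompact_iff_compactSpace.1 (isClosed_connectedComponent (x := (1 : K))).isCompact
  have hCn : ConnectedSpace C :=
    isConnected_iff_connectedSpace.1 (isConnected_connectedComponent (x := (1 : K)))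
  have hs : Function.Surjective (χ.comp C.subtype) :=
    Circle.surjective_of_connected (hχ.comp continuous_subtype_val) fun h => hχy (by
      simpa using DFunLike.congr_fun h ⟨y, hy⟩)
  set f := QuotientGroup.mk' (U : Subgroup K)
  have hfx : f x ≠ 1 := by simpa [f] using hxU
  have hord : orderOf (f x) ≠ 1 := by rwa [Ne, orderOf_eq_one_iff]
  obtain ⟨p, hp, m, hm⟩ := Nat.exists_prime_and_dvd hord
  have hmpos : orderOf (f x) ≠ 0 := (orderOf_pos _).ne'
  refine hK.false_of_prime_order (f := f) continuous_quotient_mk' hχ hp (x := x ^ m) ?_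
    fun z => ?_
  · rw [map_pow, orderOf_pow_of_dvd (by rintro rfl; simp [hm] at hmpos) (Dvd.intro_left p hm.symm),
      hm, Nat.mul_div_cancel _ (Nat.pos_of_ne_zero (by rintro rfl; simp [hm] at hmpos))]
  · obtain ⟨c, hc⟩ := hs z
    refine ⟨c, ?_, hc⟩
    simpa [f] using hCU c.2

/-- Every element lies in a compact open subgroup, which contains the nontrivial identity component
and is therefore connected by the compact case. So `G` is connected and equals any one of these
clopen subgroups. -/
theorem IsInductivelyMonothetic.compact_connected_of_not_totallyDisconnected {G : Type*}
    [CommGroup G] [TopologicalSpace G] [IsTopologicalGroup G] [LocallyCompactSpace G] [T2Space G]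
    (hG : IsInductivelyMonothetic G)
    (hc : ∀ g : G, IsCompact ((Subgroup.zpowers g).topologicalClosure : Set G))
    (htd : ¬ TotallyDisconnectedSpace G) : CompactSpace G ∧ ConnectedSpace G := by
  obtain ⟨y, hy, hy1⟩ := exists_ne_mem_isPreconnected_of_not_totallyDisconnected htd
  have key : ∀ x : G, ∃ L : Subgroup G, x ∈ L ∧ IsCompact (L : Set G) ∧ IsOpen (L : Set G) ∧
      IsConnected (L : Set G) := fun x => by
    obtain ⟨L, hCL, hLc, hLo⟩ := hG.exists_isCompact_isOpen_subgroup hc (isCompact_singleton (x := x))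
    refine ⟨L, by simpa using hCL, hLc, hLo, ?_⟩
    have hLcl := Subgroup.isClosed_of_isOpen _ hLo
    have : CompactSpace L := isCompact_iff_compactSpace.1 hLc
    have hcL : connectedComponent (1 : G) ⊆ L :=
      isPreconnected_connectedComponent.subset_isClopen ⟨hLcl, hLo⟩
        ⟨1, mem_connectedComponent, L.one_mem⟩
    have h := (hG.subgroup hLcl).totallyDisconnected_or_connected_of_compact
    refine isConnected_iff_connectedSpace.2 (h.resolve_left fun h => ?_)
    have := totallyDisconnectedSpace_subtype_iff.1 h
    exact hy1 (this _ hcL isPreconnected_connectedComponent hy mem_connectedComponent)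
  have hconn : ConnectedSpace G := by
    rw [connectedSpace_iff_connectedComponent]
    refine ⟨1, eq_univ_of_forall fun x => ?_⟩
    obtain ⟨L, hx, -, -, hL⟩ := key x
    exact hL.isPreconnected.subset_connectedComponent L.one_mem hx
  refine ⟨?_, hconn⟩
  obtain ⟨L, hx, hLc, hLo, hL⟩ := key 1
  have : (L : Set G) = univ := 
    (isClopen_iff.1 ⟨Subgroup.isClosed_of_isOpen _ hLo, hLo⟩).resolve_left
      (fun h => by
      have h1 : (1 : G) ∈ (L : Set G) := L.one_mem
      simp [h] at h1)
  exact ⟨this ▸ hLc⟩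
end

/-! ### Totally disconnected groups and `p`-adic exponents. -/

section
open Topology Filter Set
open scoped Pointwise

/-- Compact open subgroups form a neighbourhood basis of the identity in a totally disconnected
locally compact group. -/
theorem exists_isOpen_isCompact_subgroup_subset {G : Type*} [Group G] [TopologicalSpace G]
    [IsTopologicalGroup G] [LocallyCompactSpace G] [T2Space G] [TotallyDisconnectedSpace G]
    {U : Set G} (hU : U ∈ 𝓝 1) :
    ∃ V : Subgroup G, IsOpen (V : Set G) ∧ IsCompact (V : Set G) ∧ (V : Set G) ⊆ U := by
  obtain ⟨K, hK1, hKU, hK⟩ := local_compact_nhds hU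
  obtain ⟨W, hW, h1W, hWK⟩ := loc_compact_Haus_tot_disc_of_zero_dim.exists_subset_of_mem_open
    (mem_interior_iff_mem_nhds.2 hK1) isOpen_interior
  have hWK : W ⊆ K := hWK.trans interior_subset
  have hWc : IsCompact W := hK.of_isClosed_subset hW.isClosed hWK
  obtain ⟨T, hT, hTW⟩ := compact_open_separated_mul_left hWc hW.isOpen subset_rfl
  -- The stabilizer of the compact open set `W` under left translation; it lies in `W` because `1 ∈
  -- W`.
  let V : Subgroup G :=
    { carrier := {g | (∀ w ∈ W, g * w ∈ W) ∧ ∀ w ∈ W, g⁻¹ * w ∈ W}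
      mul_mem' := fun {a b} ha hb => ⟨fun w hw => by rw [mul_assoc]; exact ha.1 _ (hb.1 _ hw),
        fun w hw => by rw [mul_inv_rev, mul_assoc]; exact hb.2 _ (ha.2 _ hw)⟩
      one_mem' := by simp
      inv_mem' := fun {a} ha => ⟨ha.2, by simpa using ha.1⟩ }
  have hVW : (V : Set G) ⊆ W := fun g hg => by simpa using hg.1 1 h1W
  have hVo : IsOpen (V : Set G) := by
    refine V.isOpen_of_mem_nhds (g := 1) (mem_of_superset (inter_mem hT (inv_mem_nhds_one G hT)) ?_)
    exact fun g hg => ⟨fun w hw => hTW (mul_mem_mul hg.1 hw),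
      fun w hw => hTW (mul_mem_mul hg.2 hw)⟩
  exact ⟨V, hVo, hWc.of_isClosed_subset (Subgroup.isClosed_of_isOpen V hVo) hVW,
    hVW.trans (hWK.trans hKU)⟩

theorem nonarchimedeanGroup_of_totallyDisconnected (G : Type*) [Group G] [TopologicalSpace G]
    [IsTopologicalGroup G] [LocallyCompactSpace G] [T2Space G] [TotallyDisconnectedSpace G] :
    NonarchimedeanGroup G where
  is_nonarchimedean U hU := by
    obtain ⟨V, hV, -, hVU⟩ := exists_isOpen_isCompact_subgroup_subset hU
    exact ⟨⟨V, hV⟩, hVU⟩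

/-- Finitely many cosets of `V` cover the compact closure, so two powers of `g` share a coset. -/
theorem exists_pow_mem_of_isCompact {G : Type*} [Group G] [TopologicalSpace G]
    [IsTopologicalGroup G] {g : G}
    (hg : IsCompact ((Subgroup.zpowers g).topologicalClosure : Set G)) {V : Subgroup G}
    (hV : IsOpen (V : Set G)) : ∃ m : ℕ, m ≠ 0 ∧ g ^ m ∈ V := by
  obtain ⟨t, ht⟩ := hg.elim_finite_subcover (fun x : G => {y | x⁻¹ * y ∈ V})
    (fun x => hV.preimage (continuous_const_mul _)) (fun x _ => mem_iUnion.2 ⟨x, by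
      simp⟩)
  have hmem : ∀ n : ℕ, ∃ x ∈ t, x⁻¹ * g ^ n ∈ V := fun n => by
    have := ht (Subgroup.le_topologicalClosure _ (Subgroup.npow_mem_zpowers g n))
    simpa using this
  choose f hft hf using hmem
  obtain ⟨i, j, hij, hfij⟩ := Finite.exists_ne_map_eq_of_infinite
    (fun n : ℕ => (⟨f n, hft n⟩ : t))
  have hfij : f i = f j := congrArg Subtype.val hfij
  wlog hlt : i < j generalizing i j
  · exact this j i hij.symm (Subtype.ext hfij.symm) hfij.symm (by omega)
  refine ⟨j - i, by omega, ?_⟩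
  have h := V.mul_mem (V.inv_mem (hf i)) (hf j)
  rw [← hfij, mul_inv_rev, inv_inv, mul_assoc, mul_inv_cancel_left] at h
  rwa [pow_sub _ hlt.le, ((Commute.refl g).pow_pow j i).inv_right.eq]

section
variable {G : Type*} [CommGroup G] [TopologicalSpace G] [NonarchimedeanGroup G] [T2Space G]

omit [T2Space G] in
theorem NonarchimedeanGroup.exists_isOpen_subgroup {U : Set G} (hU : U ∈ 𝓝 1) :
    ∃ V : Subgroup G, IsOpen (V : Set G) ∧ (V : Set G) ⊆ U := by
  obtain ⟨V, hV⟩ := NonarchimedeanGroup.is_nonarchimedean U hU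
  exact ⟨V, V.isOpen, hV⟩

theorem NonarchimedeanGroup.eq_one_of_forall_mem {x : G}
    (h : ∀ V : Subgroup G, IsOpen (V : Set G) → x ∈ V) : x = 1 := by
  by_contra hx
  obtain ⟨V, hV, hVU⟩ := NonarchimedeanGroup.exists_isOpen_subgroup
    (isOpen_compl_singleton.mem_nhds (Ne.symm hx) : ({x}ᶜ : Set G) ∈ 𝓝 1)
  exact hVU (h V hV) rfl

omit [T2Space G] in
/-- A sequence of powers of an element generating a compact group converges if it is eventually
constant modulo each open subgroup. -/
theorem exists_tendsto_zpow {g : G}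
    (hg : IsCompact ((Subgroup.zpowers g).topologicalClosure : Set G)) (k : ℕ → ℤ)
    (hk : ∀ V : Subgroup G, IsOpen (V : Set G) → ∃ N, ∀ n ≥ N, g ^ (k n - k N) ∈ V) :
    ∃ x ∈ (Subgroup.zpowers g).topologicalClosure, Tendsto (fun n => g ^ k n) atTop (𝓝 x) := by
  obtain ⟨x, hx, hcl⟩ := hg (f := map (fun n => g ^ k n) atTop) (by
    rw [le_principal_iff, mem_map]
    exact Eventually.of_forall fun n =>
      Subgroup.le_topologicalClosure _ (Subgroup.zpow_mem_zpowers g _))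
  refine ⟨x, hx, fun U hU => ?_⟩
  have hU' : (fun y => x * y) ⁻¹' U ∈ 𝓝 (1 : G) :=
    (continuous_const_mul x).continuousAt.preimage_mem_nhds (by simpa using hU)
  obtain ⟨V, hV, hVU⟩ := NonarchimedeanGroup.exists_isOpen_subgroup hU'
  obtain ⟨N, hN⟩ := hk V hV
  have hxV : {y | x⁻¹ * y ∈ V} ∈ 𝓝 x :=
    (hV.preimage (continuous_const_mul x⁻¹)).mem_nhds (by simp)
  have hfreq : ∃ᶠ n in atTop, x⁻¹ * g ^ k n ∈ V :=
    Filter.frequently_map.1 (hcl.frequently hxV)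
  obtain ⟨m, hm, hmN⟩ := (hfreq.and_eventually (eventually_ge_atTop N)).exists
  rw [mem_map]
  filter_upwards [eventually_ge_atTop N] with n hn
  have h1 : x⁻¹ * g ^ k n ∈ V := by
    have : x⁻¹ * g ^ k n = (x⁻¹ * g ^ k m) * ((g ^ (k m - k N))⁻¹ * g ^ (k n - k N)) := by
      rw [← zpow_neg, ← zpow_add, mul_assoc, ← zpow_add]
      congr 2
      ring
    rw [this]
    exact V.mul_mem hm (V.mul_mem (V.inv_mem (hN m hmN)) (hN n hn))
  have h2 := hVU h1
  simpa using h2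

variable (p : ℕ) [Fact p.Prime]

omit [NonarchimedeanGroup G] [T2Space G] [Fact p.Prime] in
theorem eventually_pow_mem {g : G} (hgp : Tendsto (fun n : ℕ => g ^ p ^ n) atTop (𝓝 1))
    {V : Subgroup G} (hV : IsOpen (V : Set G)) : ∃ N, ∀ k : ℤ, (p : ℤ) ^ N ∣ k → g ^ k ∈ V := by
  obtain ⟨N, hN⟩ := (hgp.eventually (hV.mem_nhds V.one_mem)).exists
  refine ⟨N, ?_⟩
  rintro _ ⟨j, rfl⟩
  rw [zpow_mul]
  refine V.zpow_mem ?_ j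
  have : g ^ p ^ N ∈ V := hN
  exact_mod_cast this

theorem PadicInt.intCast_dvd_iff {n : ℕ} {k : ℤ} :
    (p : ℤ_[p]) ^ n ∣ (k : ℤ_[p]) ↔ (p : ℤ) ^ n ∣ k := by
  rw [← Ideal.mem_span_singleton, ← PadicInt.norm_le_pow_iff_mem_span_pow,
    PadicInt.norm_int_le_pow_iff_dvd]

/-- An element `g` with `g ^ pⁿ → 1` generating a compact group can be raised to `p`-adic integer
powers. -/
theorem exists_padicInt_hom {g : G}
    (hg : IsCompact ((Subgroup.zpowers g).topologicalClosure : Set G))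
    (hgp : Tendsto (fun n : ℕ => g ^ p ^ n) atTop (𝓝 1)) :
    ∃ f : Multiplicative ℤ_[p] →* G, Continuous f ∧ f (Multiplicative.ofAdd 1) = g := by
  -- The property characterizing `x = g ^ z`: modulo an open `V` it agrees with `g ^ k` for every
  -- integer `k` close enough to `z`. Additivity, continuity and the value at `1` are all read off
  -- modulo each `V`.
  have key : ∀ z : ℤ_[p], ∃ x : G, ∀ V : Subgroup G, IsOpen (V : Set G) → ∀ N,
      (∀ k : ℤ, (p : ℤ) ^ N ∣ k → g ^ k ∈ V) → ∀ k : ℤ, (p : ℤ_[p]) ^ N ∣ z - k →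
        (g ^ k)⁻¹ * x ∈ V := by
    intro z
    have happr : ∀ n, (p : ℤ_[p]) ^ n ∣ z - (z.appr n : ℤ) := fun n => by
      have := PadicInt.appr_spec n z
      rw [Ideal.mem_span_singleton] at this
      exact_mod_cast this
    have hdvd : ∀ N n, N ≤ n → ∀ k : ℤ, (p : ℤ_[p]) ^ N ∣ z - k →
        (p : ℤ) ^ N ∣ (z.appr n : ℤ) - k := by
      intro N n hn k hk
      rw [← PadicInt.intCast_dvd_iff]
      have h := dvd_sub hk ((pow_dvd_pow _ hn).trans (happr n))
      push_cast at h ⊢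
      simpa using h
    obtain ⟨x, -, hx⟩ := exists_tendsto_zpow hg (fun n => (z.appr n : ℤ)) (fun V hV => by
      obtain ⟨N, hN⟩ := eventually_pow_mem p hgp hV
      exact ⟨N, fun n hn => hN _ (hdvd N n hn _ (happr N))⟩)
    refine ⟨x, fun V hV N hN k hk => ?_⟩
    have h1 : Tendsto (fun n => (g ^ k)⁻¹ * g ^ (z.appr n : ℤ)) atTop (𝓝 ((g ^ k)⁻¹ * x)) :=
      hx.const_mul _
    refine (Subgroup.isClosed_of_isOpen V hV).mem_of_tendsto h1 ?_
    filter_upwards [eventually_ge_atTop N] with n hn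
    rw [← zpow_neg, ← zpow_add, neg_add_eq_sub]
    exact hN _ (hdvd N n hn k hk)
  choose f hf using key
  have happrox : ∀ (z : ℤ_[p]) (N : ℕ), ∃ k : ℤ, (p : ℤ_[p]) ^ N ∣ z - k := fun z N => by
    have := PadicInt.appr_spec N z
    rw [Ideal.mem_span_singleton] at this
    exact ⟨z.appr N, by exact_mod_cast this⟩
  have hmul : ∀ z w, f (z + w) = f z * f w := fun z w => by
    rw [← inv_mul_eq_one]
    refine NonarchimedeanGroup.eq_one_of_forall_mem fun V hV => ?_
    obtain ⟨N, hN⟩ := eventually_pow_mem p hgp hV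
    obtain ⟨k, hk⟩ := happrox z N
    obtain ⟨l, hl⟩ := happrox w N
    have h3 : (p : ℤ_[p]) ^ N ∣ (z + w) - ((k + l : ℤ) : ℤ_[p]) := by
      have := dvd_add hk hl
      push_cast
      convert this using 1
      ring
    have := V.mul_mem (V.inv_mem (hf (z + w) V hV N hN _ h3))
      (V.mul_mem (hf z V hV N hN k hk) (hf w V hV N hN l hl))
    convert this using 1
    rw [zpow_add, mul_mul_mul_comm, mul_inv_rev _ (f (z + w)), inv_inv, ← mul_inv, mul_assoc,
      mul_inv_cancel_left]
  have hsmall : ∀ (V : Subgroup G), IsOpen (V : Set G) → ∃ N, ∀ z : ℤ_[p],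
      (p : ℤ_[p]) ^ N ∣ z → f z ∈ V := fun V hV => by
    obtain ⟨N, hN⟩ := eventually_pow_mem p hgp hV
    refine ⟨N, fun z hz => ?_⟩
    simpa using hf z V hV N hN 0 (by simpa using hz)
  refine ⟨MonoidHom.mk' (fun z => f z.toAdd) fun z w => hmul _ _, ?_, ?_⟩
  · refine continuous_of_continuousAt_one _ ?_
    rw [ContinuousAt, map_one]
    intro U hU
    obtain ⟨V, hV, hVU⟩ := NonarchimedeanGroup.exists_isOpen_subgroup hU
    obtain ⟨N, hN⟩ := hsmall V hV
    have hball : Metric.closedBall (0 : ℤ_[p]) ((p : ℝ) ^ (-N : ℤ)) ∈ 𝓝 (0 : ℤ_[p]) := by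
      refine Metric.closedBall_mem_nhds _ ?_
      have : 0 < p := (Fact.out : p.Prime).pos
      positivity
    have : Metric.closedBall (0 : ℤ_[p]) ((p : ℝ) ^ (-N : ℤ)) ⊆ {z | f z ∈ U} := fun z hz => by
      refine hVU (hN z ?_)
      rw [mem_closedBall_zero_iff, PadicInt.norm_le_pow_iff_mem_span_pow,
        Ideal.mem_span_singleton] at hz
      exact hz
    have h3 : {z | f z ∈ U} ∈ 𝓝 (0 : ℤ_[p]) := mem_of_superset hball this
    exact h3
  · change f 1 = g
    rw [← inv_mul_eq_one, ← inv_eq_one, mul_inv_rev, inv_inv]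
    refine NonarchimedeanGroup.eq_one_of_forall_mem fun V hV => ?_
    obtain ⟨N, hN⟩ := eventually_pow_mem p hgp hV
    simpa using hf 1 V hV N hN 1 (by simp)

omit [NonarchimedeanGroup G] in
theorem padicInt_hom_ext {f₁ f₂ : Multiplicative ℤ_[p] →* G} (h₁ : Continuous f₁)
    (h₂ : Continuous f₂) (h : f₁ (Multiplicative.ofAdd 1) = f₂ (Multiplicative.ofAdd 1)) :
    f₁ = f₂ := by
  have : (fun z : ℤ_[p] => f₁ (Multiplicative.ofAdd z)) = fun z => f₂ (Multiplicative.ofAdd z) := by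
    refine PadicInt.denseRange_natCast.equalizer h₁ h₂ ?_
    ext n
    have hn : Multiplicative.ofAdd (n : ℤ_[p]) = (Multiplicative.ofAdd 1) ^ n := by
      rw [← ofAdd_nsmul, nsmul_one]
    simp [hn, h]
  refine MonoidHom.ext fun z => ?_
  exact congrFun this z.toAdd

theorem padicInt_hom_range {f : Multiplicative ℤ_[p] →* G} (hf : Continuous f) :
    f.range = (Subgroup.zpowers (f (Multiplicative.ofAdd 1))).topologicalClosure := by
  have hcomp : IsCompact (f.range : Set G) := by
    rw [MonoidHom.coe_range]
    have : CompactSpace (Multiplicative ℤ_[p]) := inferInstanceAs (CompactSpace ℤ_[p])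
    exact isCompact_range hf
  refine le_antisymm ?_ (Subgroup.topologicalClosure_minimal _ (by simp) hcomp.isClosed)
  rintro _ ⟨z, rfl⟩
  have hd : DenseRange fun n : ℕ => Multiplicative.ofAdd (n : ℤ_[p]) :=
    PadicInt.denseRange_natCast
  have h1 := hd.closure_range ▸ mem_univ z
  have h2 := image_closure_subset_closure_image hf ⟨z, h1, rfl⟩
  refine closure_mono ?_ h2
  rintro _ ⟨_, ⟨n, rfl⟩, rfl⟩
  refine ⟨n, ?_⟩
  simp only
  rw [← map_zpow, ← ofAdd_zsmul]
  simp

end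

/-! ### Primary components. -/

section
variable (G : Type*) [CommGroup G] [TopologicalSpace G]

section
variable [IsTopologicalGroup G]

/-- The elements `g` with `g ^ pⁿ → 1`. -/
def primaryPart (p : ℕ) : Subgroup G where
  carrier := {g | Tendsto (fun n : ℕ => g ^ p ^ n) atTop (𝓝 1)}
  mul_mem' {a b} ha hb := by
    have ha : Tendsto (fun n : ℕ => a ^ p ^ n) atTop (𝓝 1) := ha
    have hb : Tendsto (fun n : ℕ => b ^ p ^ n) atTop (𝓝 1) := hb
    simpa [mul_pow] using ha.mul hb
  one_mem' := by simpa using tendsto_const_nhds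
  inv_mem' {a} ha := by
    have ha : Tendsto (fun n : ℕ => a ^ p ^ n) atTop (𝓝 1) := ha
    simpa using ha.inv

variable {G}

theorem mem_primaryPart {p : ℕ} {g : G} :
    g ∈ primaryPart G p ↔ Tendsto (fun n : ℕ => g ^ p ^ n) atTop (𝓝 1) := Iff.rfl

theorem mem_primaryPart_subgroup {S : Subgroup G} {p : ℕ} {x : S} :
    x ∈ primaryPart S p ↔ (x : G) ∈ primaryPart G p := by
  rw [mem_primaryPart, mem_primaryPart, tendsto_subtype_rng]
  rfl

end

theorem isClosed_primaryPart [NonarchimedeanGroup G] (p : ℕ) :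
    IsClosed (primaryPart G p : Set G) := by
  rw [← closure_subset_iff_isClosed]
  intro g hg U hU
  obtain ⟨V, hV, hVU⟩ := NonarchimedeanGroup.exists_isOpen_subgroup hU
  obtain ⟨h, hh, hhp⟩ := mem_closure_iff.1 hg {h | h⁻¹ * g ∈ V} (hV.preimage (by fun_prop))
    (by simp)
  have h1 : Tendsto (fun n : ℕ => h ^ p ^ n) atTop (𝓝 1) := hhp
  rw [mem_map]
  filter_upwards [h1 (hV.mem_nhds V.one_mem)] with n hn
  refine hVU ?_
  have : g ^ p ^ n = h ^ p ^ n * (h⁻¹ * g) ^ p ^ n := by rw [← mul_pow, mul_inv_cancel_left]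
  change g ^ p ^ n ∈ V
  rw [this]
  exact V.mul_mem hn (V.pow_mem hh _)

/-- Modulo an open subgroup `U`, the closure of the powers of `g` becomes cyclic, generated by `g`.
So the index of `U` is the order of `g` modulo `U`, and it is a power of `p` exactly when some `g ^
p ^ n` lies in `U`. -/
theorem isPrimaryComponent_primaryPart [NonarchimedeanGroup G] [T2Space G]
    (hc : ∀ g : G, IsCompact ((Subgroup.zpowers g).topologicalClosure : Set G))
    (p : ℕ) [Fact p.Prime] : IsPrimaryComponent p (primaryPart G p) := by
  intro g
  set C := (Subgroup.zpowers g).topologicalClosure with hC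
  have hgC : g ∈ C := Subgroup.le_topologicalClosure _ (Subgroup.mem_zpowers g)
  constructor
  · intro hg
    refine ⟨isCompact_iff_compactSpace.1 (hc g), inferInstance, inferInstance, fun U _ hU => ?_⟩
    have hg' : (⟨g, hgC⟩ : C) ∈ primaryPart C p := mem_primaryPart_subgroup.2 hg
    obtain ⟨n, hn⟩ := ((mem_primaryPart.1 hg').eventually (hU.mem_nhds U.one_mem)).exists
    have hgen : ∀ x : C ⧸ U, x ∈ Subgroup.zpowers (QuotientGroup.mk' U ⟨g, hgC⟩) := by
      intro x
      obtain ⟨⟨x, hx⟩, rfl⟩ := QuotientGroup.mk'_surjective U x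
      have ho : IsOpen {y : C | y⁻¹ * ⟨x, hx⟩ ∈ U} := hU.preimage (by fun_prop)
      obtain ⟨O, hO, hOU⟩ := isOpen_induced_iff.1 ho
      have hxO : x ∈ O := by
        have : (⟨x, hx⟩ : C) ∈ Subtype.val ⁻¹' O := by
          rw [hOU]; simp
        exact this
      obtain ⟨y, hyO, k, rfl⟩ := mem_closure_iff.1 hx O hO hxO
      refine ⟨k, ?_⟩
      have h1 : (⟨g, hgC⟩ : C) ^ k ∈ Subtype.val ⁻¹' O := by simpa using hyO
      rw [hOU] at h1
      simp only [← map_zpow]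
      exact QuotientGroup.eq.2 h1
    have hcard := orderOf_eq_card_of_forall_mem_zpowers hgen
    rw [Subgroup.index, ← hcard]
    have hdvd : orderOf (QuotientGroup.mk' U ⟨g, hgC⟩) ∣ p ^ n := by
      rw [orderOf_dvd_iff_pow_eq_one, ← map_pow]
      exact (QuotientGroup.eq_one_iff _).2 hn
    obtain ⟨m, -, hm⟩ := (Nat.dvd_prime_pow Fact.out).1 hdvd
    exact ⟨m, hm⟩
  · intro h
    rw [mem_primaryPart]
    intro U hU
    obtain ⟨V, hV, hVU⟩ := NonarchimedeanGroup.exists_isOpen_subgroup hU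
    obtain ⟨n, hn⟩ := h.index_eq_pow (V.subgroupOf C) inferInstance
      (hV.preimage continuous_subtype_val)
    have h1 := (V.subgroupOf C).pow_index_mem (⟨g, hgC⟩ : C)
    rw [hn] at h1
    have h2 : g ^ p ^ n ∈ V := by simpa [Subgroup.mem_subgroupOf] using h1
    rw [mem_map]
    filter_upwards [eventually_ge_atTop n] with m hm
    refine hVU ?_
    obtain ⟨d, rfl⟩ := Nat.exists_eq_add_of_le hm
    change g ^ p ^ (n + d) ∈ V
    rw [pow_add, pow_mul]
    exact V.pow_mem h2 _

theorem IsPrimaryComponent.eq {H : Type*} [Group H] [TopologicalSpace H] [IsTopologicalGroup H]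
    {p : ℕ} {S T : Subgroup H} (hS : IsPrimaryComponent p S) (hT : IsPrimaryComponent p T) :
    S = T :=
  Subgroup.ext fun g => (hS g).trans (hT g).symm
end
end

/-! ### Groups with `p`-adic exponents. -/

section
open Topology Filter Set

/-- Continuous `p`-adic integer powers on a topological abelian group. -/
structure PadicPowers (p : ℕ) [Fact p.Prime] (M : Type*) [CommGroup M] [TopologicalSpace M] where
  pw : M → ℤ_[p] → M
  pw_add : ∀ g z w, pw g (z + w) = pw g z * pw g w
  continuous_pw : ∀ g, Continuous (pw g)
  pw_one : ∀ g, pw g 1 = g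

theorem exists_padicPowers (p : ℕ) [Fact p.Prime] {M : Type*} [CommGroup M] [TopologicalSpace M]
    [NonarchimedeanGroup M] [T2Space M]
    (hc : ∀ g : M, IsCompact ((Subgroup.zpowers g).topologicalClosure : Set M))
    (hp : ∀ g : M, g ∈ primaryPart M p) : Nonempty (PadicPowers p M) := by
  choose f hf h1 using fun g => exists_padicInt_hom p (hc g) (hp g)
  exact ⟨⟨fun g z => f g (Multiplicative.ofAdd z), fun g z w => by rw [ofAdd_add, map_mul],
    hf, h1⟩⟩

namespace PadicPowers

variable {p : ℕ} [Fact p.Prime] {M : Type*} [CommGroup M] [TopologicalSpace M]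
  (P : PadicPowers p M)

/-- The homomorphism `z ↦ g ^ z`. -/
noncomputable def hom (g : M) : Multiplicative ℤ_[p] →* M :=
  MonoidHom.mk' (fun z => P.pw g z.toAdd) fun _ _ => P.pw_add g _ _

theorem hom_apply (g : M) (z : Multiplicative ℤ_[p]) : P.hom g z = P.pw g z.toAdd := rfl

theorem continuous_hom (g : M) : Continuous (P.hom g) := P.continuous_pw g

theorem pw_zero (g : M) : P.pw g 0 = 1 := map_one (P.hom g)

theorem pw_intCast (g : M) (n : ℤ) : P.pw g n = g ^ n := by
  have h := map_zpow (P.hom g) (Multiplicative.ofAdd 1) n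
  rw [← ofAdd_zsmul, zsmul_one] at h
  rw [hom_apply, hom_apply, toAdd_ofAdd, toAdd_ofAdd, pw_one] at h
  exact h

theorem pw_natCast (g : M) (n : ℕ) : P.pw g n = g ^ n := by
  simpa using P.pw_intCast g n

theorem pw_pow' (g : M) (z : ℤ_[p]) (n : ℕ) : P.pw g z ^ n = P.pw g (n * z) := by
  have h := map_pow (P.hom g) (Multiplicative.ofAdd z) n
  rw [← ofAdd_nsmul, nsmul_eq_mul] at h
  exact h.symm

variable [T2Space M]

/-- Both sides are continuous homomorphisms in `w` that agree at `1`, and the integers are dense in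
`ℤ_p`. -/
theorem pw_pw (g : M) (z w : ℤ_[p]) : P.pw (P.pw g z) w = P.pw g (z * w) := by
  have h := padicInt_hom_ext p (f₁ := P.hom (P.pw g z))
    (f₂ := (P.hom g).comp (AddMonoidHom.toMultiplicative (AddMonoidHom.mulLeft z)))
    (P.continuous_hom _) ((P.continuous_hom g).comp (continuous_const_mul z)) (by
      change P.pw (P.pw g z) 1 = P.pw g (z * 1)
      rw [pw_one, mul_one])
  exact DFunLike.congr_fun h (Multiplicative.ofAdd w)

theorem one_pw (w : ℤ_[p]) : P.pw 1 w = 1 := by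
  have h := P.pw_pw 1 0 w
  rwa [zero_mul, P.pw_zero] at h

theorem pow_pw (g : M) (n : ℕ) (z : ℤ_[p]) : P.pw (g ^ n) z = P.pw g (n * z) := by
  rw [← P.pw_natCast, pw_pw]

end PadicPowers

/-- Both elements are `p`-adic powers of a common `k`, and of two `p`-adic integers one divides the
other. -/
theorem PadicPowers.comparable {p : ℕ} [Fact p.Prime] {M : Type*} [CommGroup M]
    [TopologicalSpace M] [NonarchimedeanGroup M] [T2Space M]
    (P : PadicPowers p M) (hM : IsInductivelyMonothetic M) (g h : M) :
    (∃ z, g = P.pw h z) ∨ ∃ z, h = P.pw g z := by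
  obtain ⟨k, hk⟩ := hM {g, h} (toFinite _)
  have hr : (P.hom k).range = (Subgroup.zpowers k).topologicalClosure := by
    rw [padicInt_hom_range p (P.continuous_hom k), P.hom_apply, toAdd_ofAdd, P.pw_one]
  have hgk : g ∈ (P.hom k).range := hr ▸ hk ▸
    Subgroup.le_topologicalClosure _ (Subgroup.subset_closure (by simp))
  have hhk : h ∈ (P.hom k).range := hr ▸ hk ▸
    Subgroup.le_topologicalClosure _ (Subgroup.subset_closure (by simp))
  obtain ⟨a, rfl⟩ := hgk
  obtain ⟨b, rfl⟩ := hhk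
  rcases ValuationRing.dvd_total a.toAdd b.toAdd with ⟨c, hc⟩ | ⟨c, hc⟩
  · right
    refine ⟨c, ?_⟩
    rw [P.hom_apply, P.hom_apply, P.pw_pw, hc]
  · left
    refine ⟨c, ?_⟩
    rw [P.hom_apply, P.hom_apply, P.pw_pw, hc]

section
variable {p : ℕ} [Fact p.Prime] {M : Type*} [CommGroup M] [TopologicalSpace M] [T2Space M]
  (P : PadicPowers p M)

/-- A group generated by a single element under `p`-adic powers is `ℤ_p` or finite cyclic. -/
theorem PadicPowers.isoPadicInt_or_isoCyclicPow {g : M} (hg : ∀ h, ∃ z, h = P.pw g z) :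
    IsoPadicInt p M ∨ IsoCyclicPow p M := by
  have hs : Function.Surjective (P.hom g) := fun h => by
    obtain ⟨z, hz⟩ := hg h
    exact ⟨Multiplicative.ofAdd z, hz.symm⟩
  -- The annihilator of the generator is an ideal thanks to `pw_pw`, so it is `0` or generated by a
  -- power of `p`.
  let I : Ideal ℤ_[p] :=
    { carrier := {z | P.pw g z = 1}
      add_mem' := fun {a b} ha hb => by
        have ha : P.pw g a = 1 := ha
        have hb : P.pw g b = 1 := hb
        simp [P.pw_add, ha, hb]
      zero_mem' := P.pw_zero g
      smul_mem' := fun c z hz => by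
        have hz : P.pw g z = 1 := hz
        change P.pw g (c * z) = 1
        rw [mul_comm, ← P.pw_pw, hz, P.one_pw] }
  have hI : ∀ z, z ∈ I ↔ P.pw g z = 1 := fun z => Iff.rfl
  by_cases hbot : I = ⊥
  · left
    have hinj : Function.Injective (P.hom g) := by
      rw [injective_iff_map_eq_one]
      intro z hz
      have : z.toAdd ∈ I := hz
      rw [hbot] at this
      exact this
    have : CompactSpace (Multiplicative ℤ_[p]) := inferInstanceAs (CompactSpace ℤ_[p])
    let e : Multiplicative ℤ_[p] ≃ₜ M := Continuous.homeoOfEquivCompactToT2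
      (f := Equiv.ofBijective (P.hom g) ⟨hinj, hs⟩) (P.continuous_hom g)
    let E : Multiplicative ℤ_[p] ≃ₜ* M :=
      { MulEquiv.ofBijective (P.hom g) ⟨hinj, hs⟩ with
        continuous_toFun := e.continuous_toFun
        continuous_invFun := e.continuous_invFun }
    exact ⟨E.symm⟩
  · right
    obtain ⟨n, hn⟩ := PadicInt.ideal_eq_span_pow_p hbot
    refine ⟨n, ?_⟩
    let q : Multiplicative ℤ_[p] →* Multiplicative (ZMod (p ^ n)) :=
      AddMonoidHom.toMultiplicative (PadicInt.toZModPow n : ℤ_[p] →+* ZMod (p ^ n)).toAddMonoidHom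
    have hq : Function.Surjective q := ZMod.ringHom_surjective (PadicInt.toZModPow n)
    have hker : (P.hom g).ker = q.ker := by
      ext z
      have h2 : z ∈ q.ker ↔ z.toAdd ∈ RingHom.ker (PadicInt.toZModPow (p := p) n) := Iff.rfl
      rw [h2, PadicInt.ker_toZModPow, ← hn, hI]
      rfl
    let E : M ≃* Multiplicative (ZMod (p ^ n)) :=
      (QuotientGroup.quotientKerEquivOfSurjective _ hs).symm.trans
        ((QuotientGroup.quotientMulEquivOfEq hker).trans
          (QuotientGroup.quotientKerEquivOfSurjective _ hq))
    have : NeZero (p ^ n) := ⟨pow_ne_zero _ (Fact.out : p.Prime).ne_zero⟩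
    have : Finite (ZMod (p ^ n)) := inferInstance
    have : Finite (Multiplicative (ZMod (p ^ n))) := this
    have : Finite M := Finite.of_equiv _ E.symm.toEquiv
    exact ⟨{ E with
      continuous_toFun := continuous_of_discreteTopology
      continuous_invFun := continuous_of_discreteTopology }⟩

/-- Take `h` outside the `p`-adic powers of `g`. Then `g = h ^ z` where `z` is not a unit, so `p`
divides `z`. -/
theorem PadicPowers.exists_root {g : M} (hcomp : ∀ g h : M, (∃ z, g = P.pw h z) ∨ ∃ z, h = P.pw g z)
    (hng : ∀ g, ∃ h, ∀ z, h ≠ P.pw g z) : ∃ k : M, k ^ p = g := by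
  obtain ⟨h, hh⟩ := hng g
  obtain ⟨z, hz⟩ := (hcomp g h).resolve_right fun ⟨z, hz⟩ => hh z hz
  have hzu : ¬ IsUnit z := fun ⟨u, hu⟩ => by
    refine hh (u⁻¹ : ℤ_[p]ˣ) ?_
    rw [hz, P.pw_pw, ← hu, Units.mul_inv, P.pw_one]
  rw [← mem_nonunits_iff, PadicInt.mem_nonunits, PadicInt.norm_lt_one_iff_dvd] at hzu
  obtain ⟨w, rfl⟩ := hzu
  exact ⟨P.pw h w, by rw [P.pw_pow', hz]⟩

theorem Padic.exists_padicInt_eq_pow_mul (x : ℚ_[p]) :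
    ∃ (n : ℕ) (y : ℤ_[p]), (y : ℚ_[p]) = p ^ n * x := by
  obtain ⟨n, hn⟩ := pow_unbounded_of_one_lt ‖x‖
    (by exact_mod_cast (Fact.out : p.Prime).one_lt : (1 : ℝ) < p)
  refine ⟨n, ⟨p ^ n * x, ?_⟩, rfl⟩
  rw [norm_mul, norm_pow, Padic.norm_p, inv_pow]
  have hpn : (0 : ℝ) < (p : ℝ) ^ n := by
    have := (Fact.out : p.Prime).pos
    positivity
  rw [inv_mul_le_iff₀ hpn, mul_one]
  exact hn.le

/-- `Φ x` is `s n` raised to `p ^ n * x`, for any `n` making this exponent integral. An `h` outside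
the image would have every `s n` among its powers, so `s 0` would be a `p ^ n`-th power of powers of
`h` for all `n`, forcing `s 0 = 1`. -/
theorem PadicPowers.exists_padic_surjection [IsTopologicalGroup M]
    (hcomp : ∀ g h : M, (∃ z, g = P.pw h z) ∨ ∃ z, h = P.pw g z) (s : ℕ → M) (hs0 : s 0 ≠ 1)
    (hs : ∀ n, s (n + 1) ^ p = s n) :
    ∃ Φ : Multiplicative ℚ_[p] →* M, Continuous Φ ∧ Function.Surjective Φ ∧
      ∀ (n : ℕ) (y : ℤ_[p]) (x : ℚ_[p]), (y : ℚ_[p]) = p ^ n * x →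
        Φ (Multiplicative.ofAdd x) = P.pw (s n) y := by
  have hp0 : (p : ℚ_[p]) ≠ 0 := by exact_mod_cast (Fact.out : p.Prime).ne_zero
  have hsj : ∀ j n, s (n + j) ^ p ^ j = s n := by
    intro j
    induction j with
    | zero => simp
    | succ j ih => intro n; rw [pow_succ', pow_mul, ← add_assoc, hs, ih]
  have hstep : ∀ n j (y : ℤ_[p]), P.pw (s n) y = P.pw (s (n + j)) (p ^ j * y) := by
    intro n j y
    conv_lhs => rw [← hsj j n, P.pow_pw]
    norm_cast
  choose ν y hy using Padic.exists_padicInt_eq_pow_mul (p := p)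
  have hind : ∀ (n : ℕ) (w : ℤ_[p]) (x : ℚ_[p]), (w : ℚ_[p]) = p ^ n * x →
      P.pw (s (ν x)) (y x) = P.pw (s n) w := by
    intro n w x hw
    rw [hstep (ν x) n, hstep n (ν x), add_comm n]
    congr 1
    refine PadicInt.ext ?_
    push_cast
    rw [hy, hw]
    ring
  let Φ : Multiplicative ℚ_[p] →* M := MonoidHom.mk'
    (fun x => P.pw (s (ν x.toAdd)) (y x.toAdd)) (by
      intro a b
      rw [hind (ν a.toAdd + ν b.toAdd) (p ^ ν b.toAdd * y a.toAdd + p ^ ν a.toAdd * y b.toAdd),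
        P.pw_add, ← hstep, add_comm (ν a.toAdd), ← hstep]
      push_cast
      rw [hy, hy, toAdd_mul]
      ring)
  have hΦ : ∀ (n : ℕ) (y : ℤ_[p]) (x : ℚ_[p]), (y : ℚ_[p]) = p ^ n * x →
        Φ (Multiplicative.ofAdd x) = P.pw (s n) y := fun n w x hw => hind n w x hw
  refine ⟨Φ, ?_, ?_, hΦ⟩
  · refine continuous_of_continuousAt_one _ ?_
    have h1 : ContinuousAt (fun x : ℚ_[p] => Φ (Multiplicative.ofAdd x)) ((0 : ℤ_[p]) : ℚ_[p]) := by
      refine (PadicInt.isOpenEmbedding_coe (p := p)).continuousAt_iff.1 ?_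
      have : (fun x : ℚ_[p] => Φ (Multiplicative.ofAdd x)) ∘ ((↑) : ℤ_[p] → ℚ_[p])
          = P.pw (s 0) := by
        ext z
        exact hΦ 0 z z (by simp)
      rw [this]
      exact (P.continuous_pw _).continuousAt
    exact h1
  · intro h
    by_contra! hne
    have hall : ∀ n, ∃ z, s n = P.pw h z := fun n => by
      refine (hcomp h (s n)).resolve_left fun ⟨z, hz⟩ => ?_
      refine hne (Multiplicative.ofAdd ((p ^ n : ℚ_[p])⁻¹ * z)) ?_
      rw [hz]
      exact hΦ n z _ (by rw [mul_inv_cancel_left₀ (pow_ne_zero _ hp0)])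
    choose z hz using hall
    have h0 : ∀ n, s 0 = P.pw h (p ^ n * z n) := fun n => by
      have := hsj n 0
      rw [zero_add] at this
      rw [← this, hz n, P.pw_pow']
      norm_cast
    have hlim : Tendsto (fun n => (p : ℤ_[p]) ^ n * z n) atTop (𝓝 0) := by
      rw [tendsto_zero_iff_norm_tendsto_zero]
      have hpl : Tendsto (fun n : ℕ => ((p : ℝ)⁻¹) ^ n) atTop (𝓝 0) :=
        tendsto_pow_atTop_nhds_zero_of_lt_one (by positivity)
          (inv_lt_one_of_one_lt₀ (by exact_mod_cast (Fact.out : p.Prime).one_lt))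
      refine squeeze_zero (fun _ => norm_nonneg _) (fun n => ?_) hpl
      rw [norm_mul, norm_pow, PadicInt.norm_p]
      exact mul_le_of_le_one_right (by positivity) (PadicInt.norm_le_one _)
    have h2 := ((P.continuous_pw h).tendsto 0).comp hlim
    rw [P.pw_zero] at h2
    have h3 : Tendsto (fun _ : ℕ => s 0) atTop (𝓝 1) := h2.congr fun n => (h0 n).symm
    exact hs0 (tendsto_nhds_unique tendsto_const_nhds h3)
end
end

/-! ### The Prüfer group, and the classification of the primary components. -/

section
open Topology Filter Set

theorem nonempty_mulEquiv_prufer {M : Type*} [CommGroup M] (p : ℕ) [Fact p.Prime] (s : ℕ → M)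
    (hs0 : orderOf (s 0) = p) (hs : ∀ n, s (n + 1) ^ p = s n)
    (hgen : ∀ m, ∃ n, m ∈ Subgroup.zpowers (s n)) :
    Nonempty (M ≃* Multiplicative (AddCommGroup.primaryComponent UnitAddCircle p)) := by
  have hp : p.Prime := Fact.out
  have hsj : ∀ j n, s (n + j) ^ p ^ j = s n := by
    intro j
    induction j with
    | zero => simp
    | succ j ih => intro n; rw [pow_succ', pow_mul, ← add_assoc, hs, ih]
  have hord : ∀ n, orderOf (s n) = p ^ (n + 1) := fun n => by
    have h0 : s n ^ p ^ n = s 0 := by simpa using hsj n 0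
    refine orderOf_eq_prime_pow (fun h => ?_) ?_
    · rw [h0] at h
      rw [h, orderOf_one] at hs0
      exact hp.one_lt.ne hs0
    · rw [pow_succ, pow_mul, h0, ← hs0, pow_orderOf_eq_one]
  have hpR : ∀ n : ℕ, (p : ℝ) ^ n ≠ 0 := fun n => pow_ne_zero _ (by exact_mod_cast hp.ne_zero)
  have hiff : ∀ (n n' : ℕ) (j j' : ℤ), s n ^ j = s n' ^ j' ↔
      (((j : ℝ) / p ^ (n + 1) : ℝ) : UnitAddCircle) = (((j' : ℝ) / p ^ (n' + 1) : ℝ)) := by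
    intro n n' j j'
    have e1 : s n ^ j = s (n + n') ^ ((p : ℤ) ^ n' * j) := by
      rw [zpow_mul, ← hsj n' n]
      norm_cast
    have e2 : s n' ^ j' = s (n + n') ^ ((p : ℤ) ^ n * j') := by
      rw [zpow_mul, ← hsj n n', add_comm n' n]
      norm_cast
    rw [e1, e2, ← sub_eq_zero (a := (((j : ℝ) / p ^ (n + 1) : ℝ) : UnitAddCircle)),
      ← AddCircle.coe_sub, AddCircle.coe_eq_zero_iff, ← mul_inv_eq_one, ← zpow_neg, ← zpow_add,
      ← orderOf_dvd_iff_zpow_eq_one, hord]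
    have hd : (j : ℝ) / p ^ (n + 1) - j' / p ^ (n' + 1)
        = ((p : ℝ) ^ n' * j - p ^ n * j') / p ^ (n + n' + 1) := by
      have := hpR 1
      rw [pow_one] at this
      field_simp
      ring
    rw [hd, Dvd.dvd.eq_1]
    refine exists_congr fun k => ?_
    rw [eq_div_iff (hpR _)]
    constructor
    · intro h
      have h' : (p : ℝ) ^ n' * j - p ^ n * j' = p ^ (n + n' + 1) * k := by
        rw [sub_eq_add_neg]; exact_mod_cast h
      rw [h']; simp [mul_comm]
    · intro h
      have h' : (p : ℝ) ^ n' * j + -(p ^ n * j') = p ^ (n + n' + 1) * k := by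
        rw [← sub_eq_add_neg, ← h]; simp [mul_comm]
      exact_mod_cast h'
  choose ν j hj using hgen
  have hj : ∀ m, m = s (ν m) ^ j m := fun m => (hj m).symm
  -- `s n` goes to `1 / p ^ (n + 1)`; the shift is due to `s 0` having order `p` rather than `1`.
  let θ : M → UnitAddCircle := fun m => (((j m : ℝ) / p ^ (ν m + 1) : ℝ) : UnitAddCircle)
  have hθ : ∀ (m : M) (n : ℕ) (i : ℤ), m = s n ^ i →
      θ m = (((i : ℝ) / p ^ (n + 1) : ℝ) : UnitAddCircle) := fun m n i h =>
    (hiff _ _ _ _).1 ((hj m).symm.trans h)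
  have hθmul : ∀ a b, θ (a * b) = θ a + θ b := by
    intro a b
    rw [hθ a (ν a + ν b) (p ^ ν b * j a), hθ b (ν a + ν b) (p ^ ν a * j b),
      hθ (a * b) (ν a + ν b) (p ^ ν b * j a + p ^ ν a * j b), ← AddCircle.coe_add]
    · congr 1
      push_cast
      ring
    · conv_lhs => rw [hj a, hj b, ← hsj (ν b) (ν a), ← hsj (ν a) (ν b), add_comm (ν b) (ν a)]
      rw [zpow_add, zpow_mul, zpow_mul]
      norm_cast
    · conv_lhs => rw [hj b, ← hsj (ν a) (ν b), add_comm (ν b) (ν a)]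
      rw [zpow_mul]
      norm_cast
    · conv_lhs => rw [hj a, ← hsj (ν b) (ν a)]
      rw [zpow_mul]
      norm_cast
  have hmem : ∀ m, θ m ∈ AddCommGroup.primaryComponent UnitAddCircle p := by
    intro m
    rw [AddCommGroup.mem_primaryComponent]
    have h0 : p ^ (ν m + 1) • θ m = 0 := by
      rw [← AddCircle.coe_nsmul, AddCircle.coe_eq_zero_iff]
      refine ⟨j m, ?_⟩
      have := hpR (ν m + 1)
      simp
      field_simp
    exact ⟨_, h0⟩
  let Θ : M →* Multiplicative (AddCommGroup.primaryComponent UnitAddCircle p) :=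
    MonoidHom.mk' (fun m => Multiplicative.ofAdd ⟨θ m, hmem m⟩) fun a b =>
      congrArg Multiplicative.ofAdd (Subtype.ext (hθmul a b))
  refine ⟨MulEquiv.ofBijective Θ ⟨fun a b hab => ?_, fun t => ?_⟩⟩
  · have h1 : θ a = θ b := congrArg (fun t => ((Multiplicative.toAdd t).1)) hab
    rw [hj a, hj b]
    exact (hiff _ _ _ _).2 h1
  · obtain ⟨⟨t, ht⟩, rfl⟩ := Multiplicative.ofAdd.surjective t
    obtain ⟨k, hk⟩ := AddCommGroup.mem_primaryComponent.1 ht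
    obtain ⟨r, rfl⟩ := QuotientAddGroup.mk_surjective t
    have h0 : p ^ k • ((r : ℝ) : UnitAddCircle) = 0 := hk
    rw [← AddCircle.coe_nsmul, AddCircle.coe_eq_zero_iff] at h0
    obtain ⟨i, hi⟩ := h0
    refine ⟨s k ^ ((p : ℤ) * i), congrArg Multiplicative.ofAdd (Subtype.ext ?_)⟩
    change θ (s k ^ ((p : ℤ) * i)) = ((r : ℝ) : UnitAddCircle)
    rw [hθ _ k _ rfl]
    congr 1
    have h2 : (i : ℝ) = p ^ k * r := by simpa using hi
    have h3 := hpR k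
    have h4 := hpR 1
    push_cast
    rw [h2, pow_succ]
    rw [pow_one] at h4
    field_simp

/-- Classification of inductively monothetic locally compact `p`-groups. -/
theorem IsInductivelyMonothetic.classification_primary {p : ℕ} [Fact p.Prime] {M : Type*}
    [CommGroup M] [TopologicalSpace M] [NonarchimedeanGroup M] [T2Space M] [LocallyCompactSpace M]
    (hM : IsInductivelyMonothetic M)
    (hc : ∀ g : M, IsCompact ((Subgroup.zpowers g).topologicalClosure : Set M))
    (hp : ∀ g : M, g ∈ primaryPart M p) :
    IsoPadic p M ∨ IsoPrufer p M ∨ IsoPadicInt p M ∨ IsoCyclicPow p M := by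
  obtain ⟨P⟩ := exists_padicPowers p hc hp
  have hcomp := P.comparable hM
  by_cases hng : ∃ g, ∀ h, ∃ z, h = P.pw g z
  · obtain ⟨g, hg⟩ := hng
    exact Or.inr (Or.inr (P.isoPadicInt_or_isoCyclicPow hg))
  push Not at hng
  choose root hroot using fun g => P.exists_root (g := g) hcomp hng
  let seq : M → ℕ → M := fun g n => root^[n] g
  have hseq : ∀ g n, seq g (n + 1) ^ p = seq g n := fun g n => by
    simp only [seq, Function.iterate_succ_apply']
    exact hroot _
  obtain ⟨g, hg⟩ := hng 1
  have hg1 : g ≠ 1 := by simpa [P.one_pw] using hg 0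
  obtain ⟨Φ, hΦc, hΦs, hΦ⟩ := P.exists_padic_surjection hcomp (seq g) hg1 (hseq g)
  have : SigmaCompactSpace (Multiplicative ℚ_[p]) := inferInstanceAs (SigmaCompactSpace ℚ_[p])
  have hopen : IsOpenMap Φ := Φ.isOpenMap_of_sigmaCompact hΦs hΦc
  by_cases hinj : Function.Injective Φ
  · left
    let e := (Equiv.ofBijective Φ ⟨hinj, hΦs⟩).toHomeomorphOfContinuousOpen hΦc hopen
    let E : Multiplicative ℚ_[p] ≃ₜ* M :=
      { MulEquiv.ofBijective Φ ⟨hinj, hΦs⟩ with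
        continuous_toFun := e.continuous_toFun
        continuous_invFun := e.continuous_invFun }
    exact ⟨E.symm⟩
  · right; left
    rw [injective_iff_map_eq_one] at hinj
    push Not at hinj
    obtain ⟨x, hx, hx1⟩ := hinj
    have hx0 : x.toAdd ≠ 0 := hx1
    obtain ⟨n, y, hy⟩ := Padic.exists_padicInt_eq_pow_mul x.toAdd
    have hpy : P.pw (seq g n) y = 1 := by rw [← hΦ n y _ hy, ofAdd_toAdd, hx]
    -- The kernel contains the open subgroup `x ℤ_p`. Hence `M` is discrete, and it is `p`-torsion
    -- because every element of `ℚ_p` enters `x ℤ_p` after multiplication by a power of `p`.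
    have hker : ∀ w : ℤ_[p], Φ (Multiplicative.ofAdd (x.toAdd * w)) = 1 := fun w => by
      rw [hΦ n (y * w) _ (by push_cast; rw [hy]; ring), ← P.pw_pw, hpy, P.one_pw]
    have htors : ∀ m : M, ∃ k : ℕ, m ^ p ^ k = 1 := by
      intro m
      obtain ⟨t, rfl⟩ := hΦs m
      obtain ⟨k, w, hw⟩ := Padic.exists_padicInt_eq_pow_mul (t.toAdd / x.toAdd)
      refine ⟨k, ?_⟩
      rw [← map_pow, ← hker w, hw]
      congr 1
      apply Multiplicative.toAdd.injective
      rw [toAdd_pow, toAdd_ofAdd, nsmul_eq_mul]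
      push_cast
      field_simp
    have hdisc : DiscreteTopology M := by
      refine discreteTopology_of_isOpen_singleton_one ?_
      have ho : IsOpen (range fun w : ℤ_[p] => x.toAdd * (w : ℚ_[p])) := by
        have h3 := (Homeomorph.mulLeft₀ _ hx0).isOpenMap _
          (PadicInt.isOpenEmbedding_coe (p := p)).isOpen_range
        convert h3
        ext t
        constructor
        · rintro ⟨w, rfl⟩
          exact ⟨_, ⟨w, rfl⟩, rfl⟩
        · rintro ⟨_, ⟨w, rfl⟩, rfl⟩
          exact ⟨w, rfl⟩
      have h2 := hopen _ ho
      convert h2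
      refine Subset.antisymm ?_ ?_
      · rintro _ rfl
        exact ⟨_, ⟨0, rfl⟩, hker 0⟩
      · rintro _ ⟨_, ⟨w, rfl⟩, rfl⟩
        exact hker w
    refine ⟨hdisc, ?_⟩
    obtain ⟨k, hk⟩ := htors g
    obtain ⟨a, -, ha⟩ := (Nat.dvd_prime_pow (Fact.out : p.Prime)).1 (orderOf_dvd_of_pow_eq_one hk)
    have ha0 : a ≠ 0 := by
      rintro rfl
      rw [pow_zero, orderOf_eq_one_iff] at ha
      exact hg1 ha
    obtain ⟨b, rfl⟩ := Nat.exists_eq_succ_of_ne_zero ha0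
    have hpb : p ^ b ≠ 0 := pow_ne_zero _ (Fact.out : p.Prime).ne_zero
    -- The chain of roots is restarted at an element of order exactly `p`, as the Prüfer criterion
    -- requires.
    set g' := g ^ p ^ b
    have hg' : orderOf g' = p := by
      rw [orderOf_pow_of_dvd hpb (by rw [ha]; exact pow_dvd_pow _ (Nat.le_succ b)), ha, pow_succ,
        Nat.mul_div_cancel_left _ (Nat.pos_of_ne_zero hpb)]
    have hg'1 : g' ≠ 1 := by
      rintro h
      rw [h, orderOf_one] at hg'
      exact (Fact.out : p.Prime).one_lt.ne hg'
    obtain ⟨Ψ, -, hΨs, hΨ⟩ := P.exists_padic_surjection hcomp (seq g') hg'1 (hseq g')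
    refine nonempty_mulEquiv_prufer p (seq g') hg' (hseq g') fun m => ?_
    obtain ⟨t, rfl⟩ := hΨs m
    obtain ⟨n, y, hy⟩ := Padic.exists_padicInt_eq_pow_mul t.toAdd
    refine ⟨n, ?_⟩
    rw [← ofAdd_toAdd t, hΨ n y _ hy]
    obtain ⟨l, hl⟩ := htors (seq g' n)
    have h1 := PadicInt.appr_spec l y
    rw [Ideal.mem_span_singleton] at h1
    obtain ⟨w, hw⟩ := h1
    refine ⟨y.appr l, ?_⟩
    have h2 : y = (y.appr l : ℤ_[p]) + (p ^ l : ℕ) * w := by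
      push_cast
      rw [← hw]; ring
    conv_rhs => rw [h2, P.pw_add, ← P.pow_pw, hl, P.one_pw, mul_one, P.pw_natCast]
    simp
end

/-! ### Idempotents of `∏ ℤ_q` and the projections onto sets of primes. -/

section
open Topology Filter Set

theorem Int.dvd_of_forall_prime_pow_dvd {m : ℕ} {a : ℤ}
    (h : ∀ q k : ℕ, q.Prime → q ^ k ∣ m → (q : ℤ) ^ k ∣ a) : (m : ℤ) ∣ a := by
  rw [Int.natCast_dvd, Nat.dvd_iff_prime_pow_dvd_dvd]
  intro q k hq hk
  rw [← Int.natCast_dvd]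
  exact_mod_cast h q k hq hk

/-- Integers that converge to `1` in `ℤ_q` for `q ∈ π`, and to `0` for the other primes. -/
theorem exists_idempotent_seq (π : Set ℕ) : ∃ k : ℕ → ℤ, ∀ q : ℕ, q.Prime → ∀ n, q ≤ n →
    (q ∈ π → (q : ℤ) ^ n ∣ k n - 1) ∧ (q ∉ π → (q : ℤ) ^ n ∣ k n) := by
  classical
  have key : ∀ n : ℕ, ∃ k : ℤ, ∀ q : ℕ, q.Prime → q ≤ n →
      (q ∈ π → (q : ℤ) ^ n ∣ k - 1) ∧ (q ∉ π → (q : ℤ) ^ n ∣ k) := by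
    intro n
    set A := (Finset.range (n + 1)).filter fun q => q.Prime ∧ q ∈ π
    set B := (Finset.range (n + 1)).filter fun q => q.Prime ∧ q ∉ π
    have hcop : IsCoprime (∏ q ∈ A, (q : ℤ) ^ n) (∏ q ∈ B, (q : ℤ) ^ n) := by
      refine IsCoprime.prod_left fun q hq => IsCoprime.prod_right fun r hr => IsCoprime.pow ?_
      rw [Finset.mem_filter] at hq hr
      rw [Nat.isCoprime_iff_coprime, Nat.coprime_primes hq.2.1 hr.2.1]
      rintro rfl
      exact hr.2.2 hq.2.2
    obtain ⟨u, v, huv⟩ := hcop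
    -- By the Bézout relation this multiple of the product over `B` is `1` modulo the product over
    -- `A`.
    refine ⟨v * ∏ q ∈ B, (q : ℤ) ^ n, fun q hq hqn => ⟨fun hπ => ?_, fun hπ => ?_⟩⟩
    · rw [← huv, sub_add_cancel_right, dvd_neg]
      refine Dvd.dvd.mul_left (Finset.dvd_prod_of_mem (fun q : ℕ => (q : ℤ) ^ n) ?_) _
      simp [A, hq, hπ, Nat.lt_succ_of_le hqn]
    · refine Dvd.dvd.mul_left (Finset.dvd_prod_of_mem (fun q : ℕ => (q : ℤ) ^ n) ?_) _
      simp [B, hq, hπ, Nat.lt_succ_of_le hqn]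
  choose k hk using key
  exact ⟨k, fun q hq n hn => hk n q hq hn⟩

/-- A sequence of integers representing the idempotent of `∏ ℤ_q` attached to a set of primes. -/
noncomputable def idempotentSeq (π : Set ℕ) : ℕ → ℤ := (exists_idempotent_seq π).choose

theorem idempotentSeq_dvd_sub_one {π : Set ℕ} {q n : ℕ} (hq : q.Prime) (hn : q ≤ n) (hπ : q ∈ π) :
    (q : ℤ) ^ n ∣ idempotentSeq π n - 1 :=
  ((exists_idempotent_seq π).choose_spec q hq n hn).1 hπ

theorem idempotentSeq_dvd {π : Set ℕ} {q n : ℕ} (hq : q.Prime) (hn : q ≤ n) (hπ : q ∉ π) :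
    (q : ℤ) ^ n ∣ idempotentSeq π n :=
  ((exists_idempotent_seq π).choose_spec q hq n hn).2 hπ

theorem Nat.le_and_le_of_prime_pow_dvd {q j m : ℕ} (hq : q.Prime) (hm : m ≠ 0) (hj : j ≠ 0)
    (h : q ^ j ∣ m) : q ≤ m ∧ j ≤ m := by
  have h1 := Nat.le_of_dvd (Nat.pos_of_ne_zero hm) h
  exact ⟨(Nat.le_self_pow hj q).trans h1, (Nat.lt_pow_self hq.one_lt).le.trans h1⟩

/-- If `q ^ j` divides `m` with `j ≠ 0`, then `q` and `j` are both at most `m`. So from index `m`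
on, the residues modulo all prime powers dividing `m` are settled, and the sequence converges in the
profinite integers. -/
theorem idempotentSeq_dvd_sub (π : Set ℕ) {m n n' : ℕ} (hm : m ≠ 0) (hn : m ≤ n) (hn' : m ≤ n') :
    (m : ℤ) ∣ idempotentSeq π n - idempotentSeq π n' := by
  refine Int.dvd_of_forall_prime_pow_dvd fun q j hq hj => ?_
  by_cases hj0 : j = 0
  · simp [hj0]
  obtain ⟨h1, h2⟩ := Nat.le_and_le_of_prime_pow_dvd hq hm hj0 hj
  by_cases hπ : q ∈ π
  · have a1 := (pow_dvd_pow (q : ℤ) (h2.trans hn)).trans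
      (idempotentSeq_dvd_sub_one hq (h1.trans hn) hπ)
    have a2 := (pow_dvd_pow (q : ℤ) (h2.trans hn')).trans
      (idempotentSeq_dvd_sub_one hq (h1.trans hn') hπ)
    simpa using dvd_sub a1 a2
  · exact dvd_sub ((pow_dvd_pow (q : ℤ) (h2.trans hn)).trans
      (idempotentSeq_dvd hq (h1.trans hn) hπ)) ((pow_dvd_pow (q : ℤ) (h2.trans hn')).trans
      (idempotentSeq_dvd hq (h1.trans hn') hπ))

section
variable {G : Type*} [CommGroup G] [TopologicalSpace G] [NonarchimedeanGroup G] [T2Space G]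
  (hc : ∀ g : G, IsCompact ((Subgroup.zpowers g).topologicalClosure : Set G)) (π : Set ℕ)

theorem Subgroup.zpow_mem_of_dvd {H : Type*} [Group H] {V : Subgroup H} {g : H} {m : ℕ}
    (h : g ^ m ∈ V) {k : ℤ} (hk : (m : ℤ) ∣ k) : g ^ k ∈ V := by
  obtain ⟨j, rfl⟩ := hk
  rw [zpow_mul, zpow_natCast]
  exact V.zpow_mem h j

omit [T2Space G] in
include hc in
theorem exists_idempotent_limit (g : G) : ∃ x ∈ (Subgroup.zpowers g).topologicalClosure,
    Tendsto (fun n => g ^ idempotentSeq π n) atTop (𝓝 x) := by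
  refine exists_tendsto_zpow (hc g) _ fun V hV => ?_
  obtain ⟨m, hm, hgm⟩ := exists_pow_mem_of_isCompact (hc g) hV
  exact ⟨m, fun n hn => Subgroup.zpow_mem_of_dvd hgm (idempotentSeq_dvd_sub π hm hn le_rfl)⟩

/-- The projection of a periodic abelian group to its `π`-part. -/
noncomputable def primeProj : G →* G :=
  MonoidHom.mk' (fun g => (exists_idempotent_limit hc π g).choose) (by
    intro a b
    refine tendsto_nhds_unique (exists_idempotent_limit hc π (a * b)).choose_spec.2 ?_
    have := (exists_idempotent_limit hc π a).choose_spec.2.mul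
      (exists_idempotent_limit hc π b).choose_spec.2
    simpa [mul_zpow] using this)

theorem tendsto_primeProj (g : G) :
    Tendsto (fun n => g ^ idempotentSeq π n) atTop (𝓝 (primeProj hc π g)) :=
  (exists_idempotent_limit hc π g).choose_spec.2

theorem primeProj_mem_closure (g : G) :
    primeProj hc π g ∈ (Subgroup.zpowers g).topologicalClosure :=
  (exists_idempotent_limit hc π g).choose_spec.1

theorem primeProj_mem {S : Subgroup G} (hS : IsClosed (S : Set G)) {g : G} (hg : g ∈ S) :
    primeProj hc π g ∈ S :=
  Subgroup.topologicalClosure_minimal _ (by simpa using hg) hS (primeProj_mem_closure hc π g)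

/-- The projection preserves every closed subgroup, in particular every open one. -/
theorem continuous_primeProj : Continuous (primeProj hc π) := by
  refine continuous_of_continuousAt_one _ ?_
  rw [ContinuousAt, map_one]
  intro U hU
  obtain ⟨V, hV, hVU⟩ := NonarchimedeanGroup.exists_isOpen_subgroup hU
  rw [mem_map]
  filter_upwards [hV.mem_nhds V.one_mem] with g hg
  exact hVU (primeProj_mem hc π (Subgroup.isClosed_of_isOpen V hV) hg)

theorem map_primeProj {H : Type*} [CommGroup H] [TopologicalSpace H] [NonarchimedeanGroup H]
    [T2Space H] (hcH : ∀ g : H, IsCompact ((Subgroup.zpowers g).topologicalClosure : Set H))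
    {f : G →* H} (hf : Continuous f) (g : G) :
    f (primeProj hc π g) = primeProj hcH π (f g) := by
  refine tendsto_nhds_unique ((hf.tendsto _).comp (tendsto_primeProj hc π g)) ?_
  exact (tendsto_primeProj hcH π (f g)).congr fun n => (map_zpow f g _).symm

theorem primeProj_comm (π' : Set ℕ) (g : G) :
    primeProj hc π (primeProj hc π' g) = primeProj hc π' (primeProj hc π g) :=
  map_primeProj hc π' hc (continuous_primeProj hc π) g

theorem primeProj_of_mem {q : ℕ} (hq : q.Prime) (hπ : q ∈ π) {g : G} (hg : g ∈ primaryPart G q) :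
    primeProj hc π g = g := by
  rw [← mul_inv_eq_one]
  refine NonarchimedeanGroup.eq_one_of_forall_mem fun V hV => ?_
  obtain ⟨N, hN⟩ := eventually_pow_mem q hg hV
  refine (Subgroup.isClosed_of_isOpen V hV).mem_of_tendsto
    ((tendsto_primeProj hc π g).mul_const g⁻¹) ?_
  filter_upwards [eventually_ge_atTop N, eventually_ge_atTop q] with n h1 h2
  rw [← zpow_sub_one]
  exact hN _ ((pow_dvd_pow _ h1).trans (idempotentSeq_dvd_sub_one hq h2 hπ))

theorem primeProj_of_notMem {q : ℕ} (hq : q.Prime) (hπ : q ∉ π) {g : G}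
    (hg : g ∈ primaryPart G q) : primeProj hc π g = 1 := by
  refine NonarchimedeanGroup.eq_one_of_forall_mem fun V hV => ?_
  obtain ⟨N, hN⟩ := eventually_pow_mem q hg hV
  refine (Subgroup.isClosed_of_isOpen V hV).mem_of_tendsto (tendsto_primeProj hc π g) ?_
  filter_upwards [eventually_ge_atTop N, eventually_ge_atTop q] with n h1 h2
  exact hN _ ((pow_dvd_pow _ h1).trans (idempotentSeq_dvd hq h2 hπ))

/-- If `g ^ m ∈ V`, the exponent `idempotentSeq {q} n * q ^ j` is divisible by `m` for large `n` and
`j`: the factor `q ^ j` handles the prime `q` and the idempotent handles all others. -/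
theorem primeProj_singleton_mem {q : ℕ} (hq : q.Prime) (g : G) :
    primeProj hc {q} g ∈ primaryPart G q := by
  intro U hU
  obtain ⟨V, hV, hVU⟩ := NonarchimedeanGroup.exists_isOpen_subgroup hU
  obtain ⟨m, hm, hgm⟩ := exists_pow_mem_of_isCompact (hc g) hV
  rw [mem_map]
  filter_upwards [eventually_ge_atTop m] with j hj
  refine hVU ?_
  refine (Subgroup.isClosed_of_isOpen V hV).mem_of_tendsto
    ((tendsto_primeProj hc {q} g).pow (q ^ j)) ?_
  filter_upwards [eventually_ge_atTop m] with n hn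
  rw [← zpow_natCast, ← zpow_mul]
  refine Subgroup.zpow_mem_of_dvd hgm (Int.dvd_of_forall_prime_pow_dvd fun r i hr hi => ?_)
  by_cases hi0 : i = 0
  · simp [hi0]
  obtain ⟨h1, h2⟩ := Nat.le_and_le_of_prime_pow_dvd hr hm hi0 hi
  by_cases hrq : r = q
  · subst hrq
    refine Dvd.dvd.mul_left ?_ _
    push_cast
    exact pow_dvd_pow _ (h2.trans hj)
  · exact Dvd.dvd.mul_right ((pow_dvd_pow _ (h2.trans hn)).trans
      (idempotentSeq_dvd hr (h1.trans hn) (by simpa using hrq))) _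

/-- An element all of whose primary projections lie in an open subgroup lies in that subgroup. -/
theorem mem_of_forall_primeProj_mem {V : Subgroup G} (hV : IsOpen (V : Set G)) {x : G}
    (h : ∀ q : ℕ, q.Prime → primeProj hc {q} x ∈ V) : x ∈ V := by
  classical
  by_contra hx
  have hex : ∃ m : ℕ, m ≠ 0 ∧ x ^ m ∈ V := exists_pow_mem_of_isCompact (hc x) hV
  obtain ⟨hm0, hmV⟩ := Nat.find_spec hex
  set m := Nat.find hex with hm
  have hm1 : m ≠ 1 := fun h1 => hx (by simpa [h1] using hmV)
  obtain ⟨q, hq, d, hd⟩ := Nat.exists_prime_and_dvd hm1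
  have hd0 : d ≠ 0 := by rintro rfl; exact hm0 (by simpa using hd)
  have hdm : d < m := by
    rw [hd]
    exact lt_mul_of_one_lt_left (Nat.pos_of_ne_zero hd0) hq.one_lt
  have hxd : x ^ d ∉ V := fun hxd => Nat.find_min hex hdm ⟨hd0, hxd⟩
  have hxq : (x ^ d) ^ q ∈ V := by rwa [← pow_mul, mul_comm, ← hd]
  have h1 : primeProj hc {q} (x ^ d) ∈ V := by
    rw [map_pow]
    exact V.pow_mem (h q hq) d
  have h2 := (tendsto_primeProj hc {q} (x ^ d)).eventually (hV.mem_nhds h1)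
  obtain ⟨n, hn, hnq⟩ := (h2.and (eventually_ge_atTop q)).exists
  refine hxd ?_
  -- Modulo `V` the element `x ^ d` has order `q`, so the `q`-projection fixes it there. As the
  -- projection lies in `V`, so does `x ^ d`, against the minimality of `m`.
  have h3 : (x ^ d) ^ (idempotentSeq {q} n - 1) ∈ V := by
    refine Subgroup.zpow_mem_of_dvd hxq ((dvd_pow_self _ ?_).trans
      (idempotentSeq_dvd_sub_one hq hnq rfl))
    have := hq.pos
    omega
  rw [zpow_sub_one] at h3
  have h4 := V.mul_mem (V.inv_mem h3) hn
  simpa using h4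

theorem eq_one_of_forall_primeProj {x : G} (h : ∀ q : ℕ, q.Prime → primeProj hc {q} x = 1) :
    x = 1 :=
  NonarchimedeanGroup.eq_one_of_forall_mem fun V hV =>
    mem_of_forall_primeProj_mem hc hV fun q hq => h q hq ▸ V.one_mem

theorem primeProj_singleton_primeProj {q : ℕ} (hq : q.Prime) (g : G) [Decidable (q ∈ π)] :
    primeProj hc {q} (primeProj hc π g) = if q ∈ π then primeProj hc {q} g else 1 := by
  rw [primeProj_comm]
  split_ifs with h
  · exact primeProj_of_mem hc π hq h (primeProj_singleton_mem hc hq g)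
  · exact primeProj_of_notMem hc π hq h (primeProj_singleton_mem hc hq g)

theorem primeProj_idem (g : G) : primeProj hc π (primeProj hc π g) = primeProj hc π g := by
  classical
  rw [← mul_inv_eq_one]
  refine eq_one_of_forall_primeProj hc fun q hq => ?_
  rw [map_mul, map_inv, primeProj_singleton_primeProj, primeProj_singleton_primeProj]
  · split_ifs <;> simp
  · exact hq
  · exact hq

theorem primeProj_compl_primeProj (g : G) : primeProj hc πᶜ (primeProj hc π g) = 1 := by
  classical
  refine eq_one_of_forall_primeProj hc fun q hq => ?_
  rw [primeProj_singleton_primeProj _ _ hq, primeProj_singleton_primeProj _ _ hq]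
  by_cases hπ : q ∈ π <;> simp [hπ]

theorem primeProj_mul_primeProj_compl (g : G) : primeProj hc π g * primeProj hc πᶜ g = g := by
  classical
  rw [← mul_inv_eq_one]
  refine eq_one_of_forall_primeProj hc fun q hq => ?_
  rw [map_mul, map_mul, map_inv, primeProj_singleton_primeProj _ _ hq,
    primeProj_singleton_primeProj _ _ hq]
  by_cases hπ : q ∈ π <;> simp [hπ]

/-- The closed subgroup generated by the `q`-primary parts for the primes `q ∈ π` consists of
the fixed points of the projection. -/
theorem mem_closure_primaryPart_iff {g : G} :
    g ∈ (Subgroup.closure {g : G | ∃ q : ℕ, q.Prime ∧ q ∈ π ∧ g ∈ primaryPart G q}).topologicalClosure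
      ↔ primeProj hc π g = g := by
  set H := Subgroup.closure {g : G | ∃ q : ℕ, q.Prime ∧ q ∈ π ∧ g ∈ primaryPart G q}
  constructor
  · intro hg
    let F : Subgroup G :=
      { carrier := {g | primeProj hc π g = g}
        mul_mem' := fun {a b} ha hb => by
          have ha : primeProj hc π a = a := ha
          have hb : primeProj hc π b = b := hb
          change primeProj hc π (a * b) = a * b
          rw [map_mul, ha, hb]
        one_mem' := map_one _
        inv_mem' := fun {a} ha => by
          have ha : primeProj hc π a = a := ha
          change primeProj hc π a⁻¹ = a⁻¹
          rw [map_inv, ha] }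
    have hF : IsClosed (F : Set G) := isClosed_eq (continuous_primeProj hc π) continuous_id
    refine Subgroup.topologicalClosure_minimal H ?_ hF hg
    rw [Subgroup.closure_le]
    rintro x ⟨q, hq, hπ, hx⟩
    exact primeProj_of_mem hc π hq hπ hx
  · intro hg
    classical
    rw [← SetLike.mem_coe, Subgroup.topologicalClosure_coe, mem_closure_iff_nhds]
    intro U hU
    have hU' : (fun y => g * y⁻¹) ⁻¹' U ∈ 𝓝 (1 : G) :=
      (by fun_prop : Continuous fun y => g * y⁻¹).continuousAt.preimage_mem_nhds (by simpa using hU)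
    obtain ⟨V, hV, hVU⟩ := NonarchimedeanGroup.exists_isOpen_subgroup hU'
    -- All primary projections of `g` lie in the open subgroup `H ⊔ V`: those for primes in `π` lie
    -- in `H`, the others are trivial.
    have hgHV : g ∈ H ⊔ V := by
      refine mem_of_forall_primeProj_mem hc (Subgroup.isOpen_mono le_sup_right hV) fun q hq => ?_
      rw [← hg, primeProj_singleton_primeProj _ _ hq]
      split_ifs with h
      · exact Subgroup.mem_sup_left
          (Subgroup.subset_closure ⟨q, hq, h, primeProj_singleton_mem hc hq g⟩)
      · exact one_mem _
    obtain ⟨x, hx, v, hv, hxv⟩ := Subgroup.mem_sup.1 hgHV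
    refine ⟨x, ?_, hx⟩
    have := hVU hv
    rwa [mem_preimage, ← hxv, mul_inv_cancel_right] at this

/-- Outside its `q`-primary part, a periodic abelian group is `q`-divisible. -/
theorem exists_pow_eq_mul_inv_primeProj {q : ℕ} (hq : q.Prime) (d : G) :
    ∃ y ∈ (Subgroup.zpowers d).topologicalClosure, y ^ q = d * (primeProj hc {q} d)⁻¹ := by
  have hcl : IsClosed ((fun y : G => y ^ q) '' (Subgroup.zpowers d).topologicalClosure) :=
    ((hc d).image (continuous_pow q)).isClosed
  have ht := (tendsto_primeProj hc {q} d).inv.const_mul d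
  refine hcl.mem_of_tendsto ht ?_
  filter_upwards [eventually_ge_atTop q] with n hn
  -- The approximating exponent `1 - idempotentSeq {q} n` is a multiple of `q`. The set of `q`-th
  -- powers from the compact closure is closed, so the limit is a `q`-th power too.
  obtain ⟨j, hj⟩ := (dvd_pow_self (q : ℤ) (by have := hq.pos; omega : n ≠ 0)).trans
    (idempotentSeq_dvd_sub_one hq hn (mem_singleton q))
  refine ⟨d ^ (-j), Subgroup.le_topologicalClosure _ (Subgroup.zpow_mem_zpowers d _), ?_⟩
  simp only
  rw [← zpow_natCast, ← zpow_mul, ← zpow_neg, ← zpow_one_add]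
  congr 1
  linarith
end
end

/-! ### Divisible versus reduced primary components, and passage to subgroups. -/

section
open Topology Filter Set

section
variable {p : ℕ} [Fact p.Prime] {S : Type*} [Group S] [TopologicalSpace S]

theorem IsoPadic.exists_pow_eq (h : IsoPadic p S) (s : S) : ∃ k, k ^ p = s := by
  obtain ⟨e⟩ := h
  refine ⟨e.symm (Multiplicative.ofAdd ((e s).toAdd / p)), ?_⟩
  apply e.injective
  rw [map_pow, ContinuousMulEquiv.apply_symm_apply, ← ofAdd_nsmul, nsmul_eq_mul,
    mul_div_cancel₀ _ (Nat.cast_ne_zero.2 (Fact.out : p.Prime).ne_zero)]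
  rfl

theorem IsoPadic.nontrivial (h : IsoPadic p S) : Nontrivial S := by
  obtain ⟨e⟩ := h
  exact e.toEquiv.nontrivial

theorem IsoPrufer.exists_pow_eq (h : IsoPrufer p S) (s : S) : ∃ k, k ^ p = s := by
  obtain ⟨-, ⟨e⟩⟩ := h
  have hp := (Fact.out : p.Prime)
  have key : ∀ x : AddCommGroup.primaryComponent UnitAddCircle p, ∃ y, p • y = x := by
    rintro ⟨x, n, hx⟩
    obtain ⟨r, rfl⟩ := QuotientAddGroup.mk_surjective x
    have h1 : p • ((r / p : ℝ) : UnitAddCircle) = (r : UnitAddCircle) := by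
      rw [← AddCircle.coe_nsmul, nsmul_eq_mul, mul_div_cancel₀ _ (Nat.cast_ne_zero.2 hp.ne_zero)]
    refine ⟨⟨((r / p : ℝ) : UnitAddCircle), ?_⟩, Subtype.ext h1⟩
    refine ⟨n + 1, ?_⟩
    rw [pow_succ, mul_nsmul', h1]
    exact hx
  obtain ⟨y, hy⟩ := key (e s).toAdd
  refine ⟨e.symm (Multiplicative.ofAdd y), ?_⟩
  apply e.injective
  rw [map_pow, MulEquiv.apply_symm_apply, ← ofAdd_nsmul, hy]
  rfl

theorem IsoPrufer.nontrivial (h : IsoPrufer p S) : Nontrivial S := by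
  obtain ⟨-, ⟨e⟩⟩ := h
  have hp := (Fact.out : p.Prime)
  have h1 : addOrderOf ((1 / p : ℝ) : UnitAddCircle) = p :=
    AddCircle.addOrderOf_period_div hp.pos
  have : Nontrivial (Multiplicative (AddCommGroup.primaryComponent UnitAddCircle p)) := by
    refine ⟨⟨Multiplicative.ofAdd ⟨((1 / p : ℝ) : UnitAddCircle), 1, by
      rw [pow_one]; exact (congrArg (· • _) h1).symm.trans (addOrderOf_nsmul_eq_zero _)⟩, 1, ?_⟩⟩
    intro h
    have h2 : ((1 / p : ℝ) : UnitAddCircle) = 0 := congrArg Subtype.val h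
    rw [h2, addOrderOf_zero] at h1
    exact hp.one_lt.ne h1
  exact e.toEquiv.nontrivial

/-- A nonzero `p`-adic integer has finite valuation, so it is not divisible by all powers of `p`. -/
theorem IsoPadicInt.eq_one (h : IsoPadicInt p S) {s : S} (hs : ∀ n : ℕ, ∃ k, k ^ p ^ n = s) :
    s = 1 := by
  obtain ⟨e⟩ := h
  have h1 : ∀ n : ℕ, (p : ℤ_[p]) ^ n ∣ (e s).toAdd := fun n => by
    obtain ⟨k, hk⟩ := hs n
    refine ⟨(e k).toAdd, ?_⟩
    rw [← hk, map_pow, toAdd_pow, nsmul_eq_mul, Nat.cast_pow]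
  have h2 : (e s).toAdd = 0 := by
    by_contra hne
    have h3 := (PadicInt.norm_le_pow_iff_mem_span_pow _ ((e s).toAdd.valuation + 1)).2
      (Ideal.mem_span_singleton.2 (h1 _))
    rw [PadicInt.norm_le_pow_iff_le_valuation _ hne] at h3
    omega
  exact e.injective (h2.trans (map_one e).symm)

omit [Fact p.Prime] in
theorem IsoCyclicPow.eq_one (h : IsoCyclicPow p S) {s : S} (hs : ∀ n : ℕ, ∃ k, k ^ p ^ n = s) :
    s = 1 := by
  obtain ⟨n, ⟨e⟩⟩ := h
  obtain ⟨k, rfl⟩ := hs n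
  apply e.injective
  rw [map_pow, map_one]
  change p ^ n • (e k).toAdd = 0
  rw [nsmul_eq_mul, ZMod.natCast_self, zero_mul]

/-- The primary components of `divisiblePart` and those of `procyclicPart` are different. -/
theorem not_reduced_of_divisible (h : IsoPadic p S ∨ IsoPrufer p S) :
    ¬(IsoPadicInt p S ∨ IsoCyclicPow p S) := by
  intro h'
  have hd : ∀ n : ℕ, ∀ s : S, ∃ k, k ^ p ^ n = s := by
    intro n
    induction n with
    | zero => exact fun s => ⟨s, by simp⟩
    | succ n ih =>
      intro s
      obtain ⟨k, rfl⟩ := h.elim (fun h => h.exists_pow_eq s) fun h => h.exists_pow_eq s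
      obtain ⟨l, rfl⟩ := ih k
      exact ⟨l, by rw [pow_succ, pow_mul]⟩
  have hnt : Nontrivial S := h.elim (fun h => h.nontrivial) fun h => h.nontrivial
  obtain ⟨s, hs⟩ := exists_ne (1 : S)
  exact hs (h'.elim (fun h' => h'.eq_one fun n => hd n s) fun h' => h'.eq_one fun n => hd n s)

omit [Fact p.Prime] in
theorem isoCyclicPow_of_subsingleton [Subsingleton S] : IsoCyclicPow p S := by
  refine ⟨0, ⟨⟨⟨⟨fun _ => 1, fun _ => 1, fun _ => Subsingleton.elim _ _, fun x => ?_⟩,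
    fun _ _ => rfl⟩, ?_, ?_⟩⟩⟩
  · have : Subsingleton (Multiplicative (ZMod (p ^ 0))) := by
      rw [pow_zero]; exact inferInstanceAs (Subsingleton (Fin 1))
    exact Subsingleton.elim _ _
  · exact continuous_const
  · exact continuous_const

theorem isoPadicInt_or_isoCyclicPow_congr {T : Type*} [Group T] [TopologicalSpace T] (e : T ≃ₜ* S)
    (h : IsoPadicInt p S ∨ IsoCyclicPow p S) : IsoPadicInt p T ∨ IsoCyclicPow p T :=
  h.imp (fun ⟨f⟩ => ⟨e.trans f⟩) fun ⟨n, ⟨f⟩⟩ => ⟨n, ⟨e.trans f⟩⟩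

end

theorem Subgroup.nonarchimedeanGroup {G : Type*} [Group G] [TopologicalSpace G]
    [NonarchimedeanGroup G] (S : Subgroup G) : NonarchimedeanGroup S where
  is_nonarchimedean U hU := by
    rw [nhds_subtype_eq_comap, Filter.mem_comap] at hU
    obtain ⟨W, hW, hWU⟩ := hU
    obtain ⟨V, hV⟩ := NonarchimedeanGroup.is_nonarchimedean W hW
    refine ⟨⟨V.toSubgroup.subgroupOf S, V.isOpen.preimage continuous_subtype_val⟩, fun x hx => ?_⟩
    exact hWU (hV hx)

section
variable {G : Type*} [Group G] [TopologicalSpace G] [IsTopologicalGroup G]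

theorem Subgroup.map_subtype_topologicalClosure_zpowers {S : Subgroup G} (hS : IsClosed (S : Set G))
    (x : S) : (Subtype.val '' ((Subgroup.zpowers x).topologicalClosure : Set S) : Set G) =
      (Subgroup.zpowers (x : G)).topologicalClosure := by
  have h := congrArg (fun T : Subgroup G => (T : Set G)) (MonoidHom.map_zpowers S.subtype x)
  simp only [Subgroup.coe_map, Subgroup.coe_subtype] at h
  rw [Subgroup.topologicalClosure_coe, Subgroup.topologicalClosure_coe, ← h]
  exact ((IsClosed.isClosedEmbedding_subtypeVal hS).closure_image_eq _).symm

theorem Subgroup.isCompact_topologicalClosure_zpowers {S : Subgroup G} (hS : IsClosed (S : Set G))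
    (hc : ∀ g : G, IsCompact ((Subgroup.zpowers g).topologicalClosure : Set G)) (x : S) :
    IsCompact ((Subgroup.zpowers x).topologicalClosure : Set S) := by
  rw [Subtype.isCompact_iff, Subgroup.map_subtype_topologicalClosure_zpowers hS]
  exact hc x

/-- A subgroup contains the closed subgroups generated by those of its elements that generate
a relatively compact subgroup. -/
theorem Subgroup.topologicalClosure_zpowers_le_of_isCompact [T2Space G] {S : Subgroup G} {x : S}
    (hx : IsCompact ((Subgroup.zpowers x).topologicalClosure : Set S)) :
    (Subgroup.zpowers (x : G)).topologicalClosure ≤ S := by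
  have h1 : IsClosed (((Subgroup.zpowers x).topologicalClosure.map S.subtype : Subgroup G) : Set G)
    := (hx.image continuous_subtype_val).isClosed
  refine (Subgroup.topologicalClosure_minimal _ ?_ h1).trans (Subgroup.map_subtype_le _)
  rw [Subgroup.zpowers_le]
  exact ⟨x, Subgroup.le_topologicalClosure _ (Subgroup.mem_zpowers x), rfl⟩
end
end

/-! ### The divisible and the procyclic part. -/

section
open Topology Filter Set

section
variable {G : Type*} [CommGroup G] [TopologicalSpace G] [NonarchimedeanGroup G] [T2Space G]
  (hc : ∀ g : G, IsCompact ((Subgroup.zpowers g).topologicalClosure : Set G))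

variable (G) in
/-- The primes whose primary component is isomorphic to `ℚ_p` or `ℤ(p^∞)`. -/
def divisiblePrimes : Set ℕ :=
  {p | ∃ _ : Fact p.Prime, IsoPadic p (primaryPart G p) ∨ IsoPrufer p (primaryPart G p)}

include hc in
theorem divisiblePart_eq : divisiblePart G = (Subgroup.closure {g : G | ∃ q : ℕ, q.Prime ∧
    q ∈ divisiblePrimes G ∧ g ∈ primaryPart G q}).topologicalClosure := by
  rw [divisiblePart]
  congr 2
  ext g
  constructor
  · rintro ⟨p, hp, S, hS, hS', hg⟩
    obtain rfl := hS.eq (isPrimaryComponent_primaryPart G hc p)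
    exact ⟨p, hp.out, ⟨hp, hS'⟩, hg⟩
  · rintro ⟨q, hq, ⟨hq', h⟩, hg⟩
    exact ⟨q, hq', _, isPrimaryComponent_primaryPart G hc q, h, hg⟩

include hc in
theorem procyclicPart_eq
    (hcl : ∀ p : ℕ, ∀ _ : Fact p.Prime, p ∉ divisiblePrimes G →
      IsoPadicInt p (primaryPart G p) ∨ IsoCyclicPow p (primaryPart G p)) :
    procyclicPart G = (Subgroup.closure {g : G | ∃ q : ℕ, q.Prime ∧
      q ∈ (divisiblePrimes G)ᶜ ∧ g ∈ primaryPart G q}).topologicalClosure := by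
  rw [procyclicPart]
  congr 2
  ext g
  constructor
  · rintro ⟨p, hp, S, hS, hS', hg⟩
    obtain rfl := hS.eq (isPrimaryComponent_primaryPart G hc p)
    exact ⟨p, hp.out, fun ⟨_, h⟩ => not_reduced_of_divisible h hS', hg⟩
  · rintro ⟨q, hq, h, hg⟩
    have hq' : Fact q.Prime := ⟨hq⟩
    exact ⟨q, hq', _, isPrimaryComponent_primaryPart G hc q, hcl q hq' h, hg⟩

include hc in
theorem IsInductivelyMonothetic.classification_primaryPart [LocallyCompactSpace G]
    (hG : IsInductivelyMonothetic G) (p : ℕ) [Fact p.Prime] :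
    IsoPadic p (primaryPart G p) ∨ IsoPrufer p (primaryPart G p) ∨
      IsoPadicInt p (primaryPart G p) ∨ IsoCyclicPow p (primaryPart G p) := by
  have hS := isClosed_primaryPart (G := G) p
  have := (primaryPart G p).nonarchimedeanGroup
  have : LocallyCompactSpace (primaryPart G p) := hS.isClosedEmbedding_subtypeVal.locallyCompactSpace
  exact (hG.subgroup hS).classification_primary
    (Subgroup.isCompact_topologicalClosure_zpowers hS hc) fun g => mem_primaryPart_subgroup.2 g.2

/-- A closed subgroup of a periodic abelian group that is generated by primary parts is
invariant under automorphisms. -/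
theorem isTopologicallyCharacteristic_of_mem_iff {H : Subgroup G} {π : Set ℕ}
    (hH : ∀ g, g ∈ H ↔ primeProj hc π g = g) : IsTopologicallyCharacteristic H := by
  have key : ∀ φ : G ≃ₜ* G, ∀ g ∈ H, φ g ∈ H := fun φ g hg => by
    rw [hH] at hg ⊢
    have := map_primeProj hc π hc (f := (φ : G →* G)) φ.continuous g
    rw [hg] at this
    exact this.symm
  intro φ
  ext g
  constructor
  · rintro ⟨x, hx, rfl⟩
    exact key φ x hx
  · intro hg
    exact ⟨φ.symm g, key φ.symm g hg, φ.apply_symm_apply g⟩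

/-- The inverse of multiplication is the pair of projections for `π` and its complement, which is
continuous. -/
theorem isTopologicalDirectSum_of_mem_iff {D P : Subgroup G} {π : Set ℕ}
    (hD : ∀ g, g ∈ D ↔ primeProj hc π g = g) (hP : ∀ g, g ∈ P ↔ primeProj hc πᶜ g = g) :
    IsTopologicalDirectSum D P := by
  refine ⟨fun a _ b _ => mul_comm a b, ?_⟩
  have h1 : ∀ x : P, primeProj hc π x = 1 := fun x => by
    have := primeProj_compl_primeProj hc πᶜ (x : G)
    rwa [compl_compl, (hP x).1 x.2] at this
  have h2 : ∀ x : D, primeProj hc πᶜ x = 1 := fun x => by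
    have := primeProj_compl_primeProj hc π (x : G)
    rwa [(hD x).1 x.2] at this
  let e : D × P ≃ₜ G :=
    { toFun := fun x => (x.1 * x.2 : G)
      invFun := fun g => (⟨primeProj hc π g, (hD _).2 (primeProj_idem hc π g)⟩,
        ⟨primeProj hc πᶜ g, (hP _).2 (primeProj_idem hc πᶜ g)⟩)
      left_inv := fun x => by
        refine Prod.ext (Subtype.ext ?_) (Subtype.ext ?_)
        · simp [(hD x.1).1 x.1.2, h1]
        · simp [(hP x.2).1 x.2.2, h2]
      right_inv := fun g => primeProj_mul_primeProj_compl hc π g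
      continuous_toFun := by fun_prop
      continuous_invFun := by
        have := continuous_primeProj hc π
        have := continuous_primeProj hc πᶜ
        fun_prop }
  exact e.isHomeomorph

/-- Divisibility can be checked on prime exponents. -/
theorem isDivisibleSubgroup_of_prime {H : Type*} [Group H] {D : Subgroup H}
    (h : ∀ p : ℕ, p.Prime → ∀ d ∈ D, ∃ k ∈ D, k ^ p = d) : IsDivisibleSubgroup D := by
  intro n
  induction n using Nat.recOnMul with
  | zero => exact fun h => absurd rfl h
  | one => exact fun _ d hd => ⟨d, hd, pow_one d⟩
  | prime p hp => exact fun _ => h p hp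
  | mul a b ha hb =>
    intro hab d hd
    rw [mul_ne_zero_iff] at hab
    obtain ⟨k, hk, rfl⟩ := hb hab.2 d hd
    obtain ⟨l, hl, rfl⟩ := ha hab.1 k hk
    exact ⟨l, hl, pow_mul l a b⟩

/-- To extract a `p`-th root of `d`, split off its `p`-primary projection. The remainder always has
a root in the closure of the powers of `d`; the projection has one because its component is
divisible, or is trivial when `p` is not a divisible prime. -/
theorem isDivisibleSubgroup_of_mem_iff {D : Subgroup G}
    (hD : ∀ g, g ∈ D ↔ primeProj hc (divisiblePrimes G) g = g) : IsDivisibleSubgroup D := by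
  classical
  have hDc : IsClosed (D : Set G) := by
    convert isClosed_eq (continuous_primeProj hc (divisiblePrimes G)) continuous_id using 1
    ext g
    exact hD g
  refine isDivisibleSubgroup_of_prime fun p hp d hd => ?_
  obtain ⟨y, hy, hyp⟩ := exists_pow_eq_mul_inv_primeProj hc hp d
  have hyD : y ∈ D :=
    Subgroup.topologicalClosure_minimal _ (by simpa using hd) hDc hy
  obtain ⟨z, hz, hzp⟩ : ∃ z ∈ D, z ^ p = primeProj hc {p} d := by
    by_cases hpD : p ∈ divisiblePrimes G
    · obtain ⟨hp', h⟩ := hpD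
      have hm := primeProj_singleton_mem hc hp d
      obtain ⟨z, hz⟩ : ∃ z : primaryPart G p, z ^ p = ⟨primeProj hc {p} d, hm⟩ :=
        h.elim (fun h => h.exists_pow_eq _) fun h => h.exists_pow_eq _
      exact ⟨z, (hD _).2 (primeProj_of_mem hc (divisiblePrimes G) hp ⟨hp', h⟩ z.2), congrArg Subtype.val hz⟩
    · refine ⟨1, D.one_mem, ?_⟩
      rw [one_pow, ← (hD d).1 hd, primeProj_singleton_primeProj _ _ hp, if_neg hpD]
  exact ⟨y * z, D.mul_mem hyD hz, by rw [mul_pow, hyp, hzp, inv_mul_cancel_right]⟩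

include hc in
/-- A periodic abelian group with reduced primary parts is reduced. -/
theorem IsDivisibleSubgroup.eq_bot {H : Subgroup G} (hH : IsDivisibleSubgroup H)
    (h : ∀ p : ℕ, ∀ _ : Fact p.Prime,
      IsoPadicInt p (primaryPart G p) ∨ IsoCyclicPow p (primaryPart G p)) : H = ⊥ := by
  rw [Subgroup.eq_bot_iff_forall]
  intro x hx
  refine eq_one_of_forall_primeProj hc fun q hq => ?_
  have hq' : Fact q.Prime := ⟨hq⟩
  have key : ∀ n : ℕ, ∃ k : primaryPart G q,
      k ^ q ^ n = ⟨primeProj hc {q} x, primeProj_singleton_mem hc hq x⟩ := fun n => by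
    obtain ⟨k, -, rfl⟩ := hH (q ^ n) (pow_ne_zero _ hq.ne_zero) x hx
    exact ⟨⟨_, primeProj_singleton_mem hc hq k⟩, Subtype.ext (map_pow _ _ _).symm⟩
  exact congrArg Subtype.val ((h q hq').elim (fun h => h.eq_one key) fun h => h.eq_one key)

end

theorem IsPeriodicGroup.nonarchimedeanGroup {G : Type*} [Group G] [TopologicalSpace G]
    [IsTopologicalGroup G] [T2Space G] (hG : IsPeriodicGroup G) : NonarchimedeanGroup G := by
  have := hG.locallyCompact
  have := hG.totallyDisconnected
  exact nonarchimedeanGroup_of_totallyDisconnected G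

theorem IsPiProcyclic.primaryPart_isoPadicInt_or_isoCyclicPow {G : Type*} [CommGroup G] [TopologicalSpace G]
    [IsTopologicalGroup G] [T2Space G] (hG : IsPiProcyclic G) (p : ℕ) [Fact p.Prime] :
    IsoPadicInt p (primaryPart G p) ∨ IsoCyclicPow p (primaryPart G p) := by
  have := hG.periodic.nonarchimedeanGroup
  obtain ⟨S, hS, h⟩ := hG.primary p
  obtain rfl := hS.eq (isPrimaryComponent_primaryPart G hG.periodic.compact_zpowers p)
  exact h

theorem IsDivisibleSubgroup.eq_bot_of_isPiProcyclic {G : Type*} [CommGroup G] [TopologicalSpace G]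
    [IsTopologicalGroup G] [T2Space G] (hG : IsPiProcyclic G) {H : Subgroup G}
    (hH : IsDivisibleSubgroup H) : H = ⊥ := by
  have := hG.periodic.nonarchimedeanGroup
  exact hH.eq_bot hG.periodic.compact_zpowers fun p _ => hG.primaryPart_isoPadicInt_or_isoCyclicPow p

theorem IsDivisibleSubgroup.map {G H : Type*} [Group G] [Group H] {D : Subgroup G}
    (hD : IsDivisibleSubgroup D) (f : G →* H) : IsDivisibleSubgroup (D.map f) := by
  rintro n hn _ ⟨d, hd, rfl⟩
  obtain ⟨k, hk, rfl⟩ := hD n hn d hd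
  exact ⟨f k, ⟨k, hk, rfl⟩, (map_pow f k n).symm⟩

/-- The primary components of a subgroup that contains a primary component of the group. -/
noncomputable def primaryPartSubgroupEquiv {G : Type*} [CommGroup G] [TopologicalSpace G]
    [IsTopologicalGroup G] {S : Subgroup G} {p : ℕ} (h : primaryPart G p ≤ S) :
    primaryPart S p ≃ₜ* primaryPart G p where
  toFun x := ⟨x, mem_primaryPart_subgroup.1 x.2⟩
  invFun x := ⟨⟨x, h x.2⟩, mem_primaryPart_subgroup.2 x.2⟩
  left_inv _ := rfl
  right_inv _ := rfl
  map_mul' _ _ := rfl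
  continuous_toFun := by fun_prop
  continuous_invFun := by fun_prop
end

/-! ### Structure of periodic groups, and the trichotomy. -/

section
open Topology Filter Set

section

/-- A `Π`-procyclic subgroup that meets the `π`-part trivially has no `π`-part. -/
theorem primeProj_compl_eq_self_of_disjoint {G : Type*} [CommGroup G] [TopologicalSpace G]
    [NonarchimedeanGroup G] [T2Space G]
    (hc : ∀ g : G, IsCompact ((Subgroup.zpowers g).topologicalClosure : Set G)) {π : Set ℕ}
    {D H : Subgroup G} (hD : ∀ g, g ∈ D ↔ primeProj hc π g = g) (hH : IsPiProcyclic H)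
    (h : D ⊓ H = ⊥) {x : G} (hx : x ∈ H) : primeProj hc πᶜ x = x := by
  have h1 : primeProj hc π x ∈ H :=
    Subgroup.topologicalClosure_zpowers_le_of_isCompact (hH.periodic.compact_zpowers ⟨x, hx⟩)
      (primeProj_mem_closure hc π x)
  have h2 : primeProj hc π x ∈ D ⊓ H := ⟨(hD _).2 (primeProj_idem hc π x), h1⟩
  rw [h, Subgroup.mem_bot] at h2
  have h3 := primeProj_mul_primeProj_compl hc π x
  rwa [h2, one_mul] at h3

/-- The projection along `K` carries `D` to a divisible subgroup of the `Π`-procyclic group `H`,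
which is trivial. The same projection fixes `D ⊓ H`. -/
theorem inf_eq_bot_of_isTopologicalDirectSum {G : Type*} [CommGroup G] [TopologicalSpace G]
    [IsTopologicalGroup G] [T2Space G] {D H K : Subgroup G} (hD : IsDivisibleSubgroup D)
    (hH : IsPiProcyclic H) (hK : IsTopologicalDirectSum H K) : D ⊓ H = ⊥ := by
  let f : H × K →* G := H.subtype.coprod K.subtype
  let e : H × K ≃* G := MulEquiv.ofBijective f hK.2.bijective
  have h1 := (hD.map ((MonoidHom.fst H K).comp e.symm.toMonoidHom)).eq_bot_of_isPiProcyclic hH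
  rw [Subgroup.eq_bot_iff_forall] at h1 ⊢
  rintro x ⟨hxD, hxH⟩
  have h2 : e.symm x = (⟨x, hxH⟩, 1) := by
    rw [MulEquiv.symm_apply_eq]
    exact (mul_one x).symm
  have h3 := h1 _ ⟨x, hxD, rfl⟩
  have h4 : (e.symm x).1 = 1 := h3
  rw [h2] at h4
  exact congrArg Subtype.val h4

theorem IsTopologicalDirectSum.symm {G : Type*} [CommGroup G] [TopologicalSpace G] {A B : Subgroup G} (h : IsTopologicalDirectSum A B) :
    IsTopologicalDirectSum B A := by
  refine ⟨fun a _ b _ => mul_comm a b, ?_⟩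
  convert h.2.comp (Homeomorph.prodComm B A).isHomeomorph using 1
  funext x
  exact mul_comm _ _

/-- The primary components of `P` are those of `G` for the primes in `π`, and trivial for the
others. -/
theorem isPiProcyclic_of_mem_iff {G : Type*} [CommGroup G] [TopologicalSpace G]
    [NonarchimedeanGroup G] [T2Space G] [LocallyCompactSpace G] [TotallyDisconnectedSpace G]
    (hc : ∀ g : G, IsCompact ((Subgroup.zpowers g).topologicalClosure : Set G)) {π : Set ℕ}
    {P : Subgroup G} (hP : ∀ g, g ∈ P ↔ primeProj hc π g = g)
    (h : ∀ p : ℕ, ∀ _ : Fact p.Prime, p ∈ π →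
      IsoPadicInt p (primaryPart G p) ∨ IsoCyclicPow p (primaryPart G p)) : IsPiProcyclic P := by
  have hPc : IsClosed (P : Set G) := by
    convert isClosed_eq (continuous_primeProj hc π) continuous_id using 1
    ext g
    exact hP g
  have hc' := Subgroup.isCompact_topologicalClosure_zpowers hPc hc
  have := P.nonarchimedeanGroup
  refine ⟨mul_comm, ⟨hPc.isClosedEmbedding_subtypeVal.locallyCompactSpace, inferInstance, hc'⟩,
    fun p hp => ⟨_, isPrimaryComponent_primaryPart P hc' p, ?_⟩⟩
  by_cases hpπ : p ∈ π
  · exact isoPadicInt_or_isoCyclicPow_congr (primaryPartSubgroupEquiv fun g hg =>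
      (hP g).2 (primeProj_of_mem hc π hp.out hpπ hg)) (h p hp hpπ)
  · have : Subsingleton (primaryPart P p) := by
      refine subsingleton_of_forall_eq 1 fun x => Subtype.ext (Subtype.ext ?_)
      have h1 := primeProj_of_notMem hc π hp.out hpπ (mem_primaryPart_subgroup.1 x.2)
      rwa [(hP _).1 x.1.2] at h1
    exact Or.inr isoCyclicPow_of_subsingleton

variable {G : Type*} [CommGroup G] [TopologicalSpace G] [IsTopologicalGroup G] [T2Space G]

/-- Structure of periodic inductively monothetic groups. -/
theorem IsInductivelyMonothetic.structure_of_isPeriodicGroup (hG : IsInductivelyMonothetic G)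
    (hper : IsPeriodicGroup G) :
    IsTopologicallyCharacteristic (divisiblePart G) ∧
    IsTopologicallyCharacteristic (procyclicPart G) ∧
    IsTopologicalDirectSum (divisiblePart G) (procyclicPart G) ∧
    IsGreatest {H : Subgroup G | IsDivisibleSubgroup H} (divisiblePart G) ∧
    IsGreatest {H : Subgroup G | IsPiProcyclic H ∧ divisiblePart G ⊓ H = ⊥} (procyclicPart G) ∧
    IsGreatest {H : Subgroup G | IsPiProcyclic H ∧ ∃ K : Subgroup G, IsTopologicalDirectSum H K}
      (procyclicPart G) := by
  have := hper.nonarchimedeanGroup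
  have := hper.locallyCompact
  have := hper.totallyDisconnected
  have hc := hper.compact_zpowers
  have hred : ∀ p : ℕ, ∀ _ : Fact p.Prime, p ∈ (divisiblePrimes G)ᶜ →
      IsoPadicInt p (primaryPart G p) ∨ IsoCyclicPow p (primaryPart G p) := fun p hp h => by
    rcases hG.classification_primaryPart hc p with h1 | h1 | h1
    · exact absurd ⟨hp, Or.inl h1⟩ h
    · exact absurd ⟨hp, Or.inr h1⟩ h
    · exact h1
  have hD : ∀ g, g ∈ divisiblePart G ↔ primeProj hc (divisiblePrimes G) g = g := fun g => by
    rw [divisiblePart_eq hc, mem_closure_primaryPart_iff hc]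
  have hP : ∀ g, g ∈ procyclicPart G ↔ primeProj hc (divisiblePrimes G)ᶜ g = g := fun g => by
    rw [procyclicPart_eq hc hred, mem_closure_primaryPart_iff hc]
  have hDdiv := isDivisibleSubgroup_of_mem_iff hc hD
  have hPpro := isPiProcyclic_of_mem_iff hc hP hred
  have hsum := isTopologicalDirectSum_of_mem_iff hc hD hP
  have hle : ∀ H : Subgroup G, IsPiProcyclic H → divisiblePart G ⊓ H = ⊥ → H ≤ procyclicPart G :=
    fun H hH h x hx => (hP x).2 (primeProj_compl_eq_self_of_disjoint hc hD hH h hx)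
  refine ⟨isTopologicallyCharacteristic_of_mem_iff hc hD,
    isTopologicallyCharacteristic_of_mem_iff hc hP, hsum, ⟨hDdiv, fun H hH x hx => ?_⟩,
    ⟨⟨hPpro, inf_eq_bot_of_isTopologicalDirectSum hDdiv hPpro hsum.symm⟩, fun H hH =>
      hle H hH.1 hH.2⟩, ⟨hPpro, _, hsum.symm⟩, ?_⟩
  -- A divisible subgroup has divisible, hence trivial, image in the procyclic part, so it lies in
  -- the kernel of that projection, which is the divisible part.
  · let f : G →* procyclicPart G := (primeProj hc (divisiblePrimes G)ᶜ).codRestrict _ fun g =>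
      (hP _).2 (primeProj_idem hc _ g)
    have h1 := (hH.map f).eq_bot_of_isPiProcyclic hPpro
    rw [Subgroup.eq_bot_iff_forall] at h1
    have h2 : primeProj hc (divisiblePrimes G)ᶜ x = 1 := congrArg Subtype.val (h1 _ ⟨x, hx, rfl⟩)
    have h3 := primeProj_mul_primeProj_compl hc (divisiblePrimes G) x
    rw [h2, mul_one] at h3
    exact (hD x).2 h3
  · rintro H ⟨hH, K, hK⟩
    exact hle H hH (inf_eq_bot_of_isTopologicalDirectSum hDdiv hH hK)

theorem IsInductivelyMonothetic.trichotomy [LocallyCompactSpace G]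
    (hG : IsInductivelyMonothetic G) :
    (CompactSpace G ∧ ConnectedSpace G ∧ smallInductiveDimension G = 1) ∨
      (DiscreteTopology G ∧ ∃ H : AddSubgroup ℚ, Nonempty (G ≃* Multiplicative H)) ∨
      (IsPeriodicGroup G ∧ ∀ (p : ℕ) [Fact p.Prime], ∃ S : Subgroup G, IsPrimaryComponent p S ∧
          (IsoPadic p S ∨ IsoPrufer p S ∨ IsoPadicInt p S ∨ IsoCyclicPow p S)) := by
  by_cases hc : ∀ g : G, IsCompact ((Subgroup.zpowers g).topologicalClosure : Set G)
  · by_cases htd : TotallyDisconnectedSpace G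
    · have hper : IsPeriodicGroup G := ⟨inferInstance, htd, hc⟩
      have := hper.nonarchimedeanGroup
      exact Or.inr (Or.inr ⟨hper, fun p hp => ⟨_, isPrimaryComponent_primaryPart G hc p,
        hG.classification_primaryPart hc p⟩⟩)
    · obtain ⟨h1, h2⟩ := hG.compact_connected_of_not_totallyDisconnected hc htd
      obtain ⟨y, -, hy⟩ := exists_ne_mem_isPreconnected_of_not_totallyDisconnected htd
      have : Nontrivial G := ⟨y, 1, hy⟩
      exact Or.inl ⟨h1, h2, hG.smallInductiveDimension_eq_one⟩
  · push Not at hc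
    obtain ⟨g, hg⟩ := hc
    exact Or.inr (Or.inl (hG.discrete_rational hg))
end
end

theorem mainTheorem6 {G : Type*} [Group G] [TopologicalSpace G] [IsTopologicalGroup G]
    [LocallyCompactSpace G] [T2Space G] (hG : IsInductivelyMonothetic G) :
    (((∀ a b : G, a * b = b * a) ∧ CompactSpace G ∧ ConnectedSpace G ∧
        smallInductiveDimension G = 1) ∨
      (DiscreteTopology G ∧ ∃ H : AddSubgroup ℚ, Nonempty (G ≃* Multiplicative H)) ∨
      ((∀ a b : G, a * b = b * a) ∧ IsPeriodicGroup G ∧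
        ∀ (p : ℕ) [Fact p.Prime], ∃ S : Subgroup G, IsPrimaryComponent p S ∧
          (IsoPadic p S ∨ IsoPrufer p S ∨ IsoPadicInt p S ∨ IsoCyclicPow p S))) ∧
    (IsPeriodicGroup G →
      IsClosed (divisiblePart G : Set G) ∧ IsClosed (procyclicPart G : Set G) ∧
      IsTopologicallyCharacteristic (divisiblePart G) ∧
      IsTopologicallyCharacteristic (procyclicPart G) ∧
      IsTopologicalDirectSum (divisiblePart G) (procyclicPart G) ∧
      IsGreatest {H : Subgroup G | IsDivisibleSubgroup H} (divisiblePart G) ∧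
      IsGreatest {H : Subgroup G | IsPiProcyclic H ∧ divisiblePart G ⊓ H = ⊥}
        (procyclicPart G) ∧
      IsGreatest {H : Subgroup G | IsPiProcyclic H ∧ ∃ K : Subgroup G, IsTopologicalDirectSum H K}
        (procyclicPart G)) := by
  -- The commutative structure extends the given group structure, so all notions stated for `G` keep
  -- their meaning.
  let : CommGroup G := { ‹Group G› with mul_comm := hG.commute }
  refine ⟨?_, fun hper => ⟨Subgroup.isClosed_topologicalClosure _,
    Subgroup.isClosed_topologicalClosure _, hG.structure_of_isPeriodicGroup hper⟩⟩
  exact hG.trichotomy.imp (fun h => ⟨hG.commute, h⟩) (Or.imp_right fun h => ⟨hG.commute, h⟩)
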